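/- **Theorem 1.** Let $N\in\mathbb N$, $0<s<1$, $2s<N$, put $2_s^*=\frac{2N}{N-2s}$ and let $2<q<2_s^*$. Write $$[u]_s=\Big(\iint_{\mathbb R^{2N}}\frac{|u(x)-u(y)|^2}{|x-y|^{N+2s}}\,dx\,dy\Big)^{1/2},$$ and let $D^s(\mathbb R^N)$ be the completion of $C_c^\infty(\mathbb R^N)$ with respect to $[\cdot]_s$, realised as a space of functions in $L^{2_s^*}(\mathbb R^N)$. Let $w:\mathbb R^N\to\mathbb R$ (possibly sign-changing) satisfy * (W$_1$) there is a non-empty open set $\Omega\subset\mathbb R^N$ with $w>0$ a.e. in $\Omega$; * (W$_2$) there is $\nu$ with $q<\nu<2_s^*$ such that $w\in L^\tau(\mathbb R^N)$ for every $\tau\in\Big[\frac{2_s^*}{2_s^*-q},\ \frac{\nu}{\nu-1}\,\frac{2_s^*}{2_s^*-q}\Big]$. Then the problem $(-\Delta)^su=\lambda\,w(x)|u|^{q-2}u$ in $\mathbb R^N$ has a nontrivial weak solution: there is $u\in D^s(\mathbb R^N)$, $u\neq0$, such that $\int_{\mathbb R^N}w|u|^q\,dx>0$ and, with $$\lambda=\frac{q\big([u]_s^2+[u]_s^{2_s^*}\big)}{\big(2+2_s^*[u]_s^{2_s^*-2}\big)\int_{\mathbb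 R^N}w(x)|u|^q\,dx}>0,$$ one has, for all $\varphi\in D^s(\mathbb R^N)$ (all integrals converging absolutely), $$\iint_{\mathbb R^{2N}}\frac{[u(x)-u(y)][\varphi(x)-\varphi(y)]}{|x-y|^{N+2s}}\,dx\,dy=\lambda\int_{\mathbb R^N}w(x)|u|^{q-2}u\,\varphi\,dx .$$ Moreover $u$ can be chosen to be a maximizer, over all $v\in D^s(\mathbb R^N)\setminus\{0\}$, of $$J(v)=\frac{\int_{\mathbb R^N}w(x)|v|^q\,dx}{[v]_s^2+[v]_s^{2_s^*}} .$$ -/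

import Mathlib

open MeasureTheory Filter Topology
open scoped ENNReal ContDiff

namespace FracEigen

/-- The fractional critical Sobolev exponent `2_s^* = 2N / (N - 2s)`. -/
noncomputable def critExp (N : ℕ) (s : ℝ) : ℝ := 2 * N / (N - 2 * s)

/-- The Gagliardo seminorm
`(∬ |u(x) - u(y)|² / |x - y|^(N + 2s) dx dy)^(1/2)`, with values in `[0, ∞]`. -/
noncomputable def eGagliardo {N : ℕ} (s : ℝ) (u : EuclideanSpace ℝ (Fin N) → ℝ) : ℝ≥0∞ :=
  (∫⁻ p : EuclideanSpace ℝ (Fin N) × EuclideanSpace ℝ (Fin N),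
    ENNReal.ofReal (|u p.1 - u p.2| ^ 2 / ‖p.1 - p.2‖ ^ ((N : ℝ) + 2 * s))) ^ (1 / 2 : ℝ)

/-- The Gagliardo seminorm as a real number (it is finite on the space `D^s`). -/
noncomputable def gagliardo {N : ℕ} (s : ℝ) (u : EuclideanSpace ℝ (Fin N) → ℝ) : ℝ :=
  (eGagliardo s u).toReal

/-- Membership in `D^s(ℝ^N)`, the completion of `C_c^∞(ℝ^N)` for the Gagliardo norm, realised as
usual as a space of functions inside `L^{2_s^*}(ℝ^N)`: the limits, in the Gagliardo norm and in
`L^{2_s^*}`, of sequences of smooth compactly supported functions. -/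
def MemDs {N : ℕ} (s : ℝ) (u : EuclideanSpace ℝ (Fin N) → ℝ) : Prop :=
  MemLp u (ENNReal.ofReal (critExp N s)) volume ∧
  ∃ φ : ℕ → EuclideanSpace ℝ (Fin N) → ℝ,
    (∀ n, ContDiff ℝ ∞ (φ n) ∧ HasCompactSupport (φ n)) ∧
    Tendsto (fun n => eGagliardo s (fun x => φ n x - u x)) atTop (𝓝 0) ∧
    Tendsto (fun n => eLpNorm (fun x => φ n x - u x) (ENNReal.ofReal (critExp N s)) volume)
      atTop (𝓝 0)

/-- The integrand `[u(x) - u(y)][φ(x) - φ(y)] / |x - y|^(N + 2s)` of the bilinear form of the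
fractional Laplacian. -/
noncomputable def formIntegrand {N : ℕ} (s : ℝ) (u φ : EuclideanSpace ℝ (Fin N) → ℝ)
    (p : EuclideanSpace ℝ (Fin N) × EuclideanSpace ℝ (Fin N)) : ℝ :=
  (u p.1 - u p.2) * (φ p.1 - φ p.2) / ‖p.1 - p.2‖ ^ ((N : ℝ) + 2 * s)

/-- `u ∈ D^s(ℝ^N)` is a weak solution of `(-Δ)^s u = l w |u|^(q-2) u` in `ℝ^N` with parameter
`l > 0`. Both integrals in the weak formulation are required to converge absolutely. -/
def IsWeakSolution {N : ℕ} (s q : ℝ) (w : EuclideanSpace ℝ (Fin N) → ℝ) (l : ℝ)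
    (u : EuclideanSpace ℝ (Fin N) → ℝ) : Prop :=
  MemDs s u ∧ 0 < l ∧
  ∀ φ : EuclideanSpace ℝ (Fin N) → ℝ, MemDs s φ →
    Integrable (formIntegrand s u φ) volume ∧
    Integrable (fun x => w x * |u x| ^ (q - 2) * u x * φ x) volume ∧
    ∫ p, formIntegrand s u φ p = l * ∫ x, w x * |u x| ^ (q - 2) * u x * φ x

/-- The quotient `J(u) = ∫ w |u|^q / ([u]_s² + [u]_s^(2_s^*))`. -/
noncomputable def quotientJ {N : ℕ} (s q : ℝ) (w u : EuclideanSpace ℝ (Fin N) → ℝ) : ℝ :=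
  (∫ x, w x * |u x| ^ q) / (gagliardo s u ^ 2 + gagliardo s u ^ critExp N s)

end FracEigen

/-! The proof is the direct method for `J`. Write p for the critical exponent. Hölder, with w in
L^{p/(p-q)}, and the Sobolev inequality bound the numerator by C[u]^q; since 2 < q < p, t^q ≤ t² +
t^p, so `J` is bounded above. A bump inside Ω makes the supremum S positive. Once J(v) ≥ S/2, the
same exponents keep [v] between two positive constants, so a maximizing sequence neither vanishes
nor blows up. Along a subsequence the seminorms tend to some a > 0 and the functions converge a.e.
to some u in D^s. The numerators converge, so ∫ w|u|^q = S(a² + a^p) > 0, and [u] ≤ a by Fatou;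
hence J(u) ≥ S. The first order condition along u + tφ is the equation, with the stated λ
(`deriv_eq_of_isLocalMax`).

Ball averages drive the analysis. The distance from u(x) to its mean over B(x,r) is at most A r^s
G(x), where G² is `gagliardoDensity`, and the mean is at most B r^{-(N-2s)/2}‖u‖_p. Choosing r well
and integrating gives the Sobolev inequality (`exists_eLpNorm_le_eGagliardo`). The first estimate
also replaces Rellich: bounded sequences are uniformly close in L² to their averages, and these
converge along a weakly convergent subsequence (`exists_subseq_tendsto_ae`).

No compact embedding at the exponent p is needed: w is a fixed function of the dual class, so the
functions w|u_n|^q are uniformly integrable and tight, and Vitali applies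
(`tendsto_integral_mul_abs_rpow`). -/

namespace FracEigen

variable {N : ℕ} {s q : ℝ}

/-! ### Difference quotients as functions on pairs of points -/

/-- The difference quotient `(u(x) - u(y)) / |x - y|^((N + 2s)/2)`, whose `L²` norm is the
Gagliardo seminorm. -/
noncomputable def diffQuot (s : ℝ) (u : EuclideanSpace ℝ (Fin N) → ℝ)
    (p : EuclideanSpace ℝ (Fin N) × EuclideanSpace ℝ (Fin N)) : ℝ :=
  (u p.1 - u p.2) / ‖p.1 - p.2‖ ^ (((N : ℝ) + 2 * s) / 2)

lemma kernel_sq (s : ℝ) (z : EuclideanSpace ℝ (Fin N)) :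
    ‖z‖ ^ (((N : ℝ) + 2 * s) / 2) * ‖z‖ ^ (((N : ℝ) + 2 * s) / 2) = ‖z‖ ^ ((N : ℝ) + 2 * s) := by
  rw [← pow_two, ← Real.rpow_mul_natCast (norm_nonneg z)]
  congr 1
  push_cast
  ring

lemma diffQuot_mul (u v : EuclideanSpace ℝ (Fin N) → ℝ) (p) :
    diffQuot s u p * diffQuot s v p = formIntegrand s u v p := by
  simp only [diffQuot, formIntegrand]
  rw [div_mul_div_comm, kernel_sq]

lemma diffQuot_sq (u : EuclideanSpace ℝ (Fin N) → ℝ) (p) :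
    diffQuot s u p ^ 2 = |u p.1 - u p.2| ^ 2 / ‖p.1 - p.2‖ ^ ((N : ℝ) + 2 * s) := by
  rw [pow_two, diffQuot_mul, formIntegrand, sq_abs, pow_two]

lemma enorm_diffQuot_sq (u : EuclideanSpace ℝ (Fin N) → ℝ) (p) :
    ‖diffQuot s u p‖ₑ ^ (2 : ℝ) =
      ENNReal.ofReal (|u p.1 - u p.2| ^ 2 / ‖p.1 - p.2‖ ^ ((N : ℝ) + 2 * s)) := by
  rw [← diffQuot_sq, ENNReal.rpow_two, ← sq_abs, ENNReal.ofReal_pow (abs_nonneg _),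
    Real.enorm_eq_ofReal_abs]

/-- This makes Minkowski, completeness, weak compactness and Fatou available from L² on pairs of
points. -/
lemma eGagliardo_eq_eLpNorm (s : ℝ) (u : EuclideanSpace ℝ (Fin N) → ℝ) :
    eGagliardo s u = eLpNorm (diffQuot s u) 2 volume := by
  rw [eLpNorm_eq_lintegral_rpow_enorm_toReal (by norm_num) (by norm_num), eGagliardo]
  simp only [ENNReal.toReal_ofNat, enorm_diffQuot_sq]

lemma diffQuot_add (u v : EuclideanSpace ℝ (Fin N) → ℝ) :
    diffQuot s (fun x => u x + v x) = diffQuot s u + diffQuot s v := by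
  ext p; simp only [diffQuot, Pi.add_apply]; ring

lemma diffQuot_sub (u v : EuclideanSpace ℝ (Fin N) → ℝ) :
    diffQuot s (fun x => u x - v x) = diffQuot s u - diffQuot s v := by
  ext p; simp only [diffQuot, Pi.sub_apply]; ring

lemma diffQuot_const_mul (c : ℝ) (u : EuclideanSpace ℝ (Fin N) → ℝ) :
    diffQuot s (fun x => c * u x) = c • diffQuot s u := by
  ext p; simp only [diffQuot, Pi.smul_apply, smul_eq_mul]; ring

lemma diffQuot_congr_ae {u v : EuclideanSpace ℝ (Fin N) → ℝ} (h : u =ᵐ[volume] v) :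
    diffQuot s u =ᵐ[volume] diffQuot s v := by
  have h1 : ∀ᵐ p : EuclideanSpace ℝ (Fin N) × EuclideanSpace ℝ (Fin N), u p.1 = v p.1 :=
    Measure.quasiMeasurePreserving_fst.ae h
  have h2 : ∀ᵐ p : EuclideanSpace ℝ (Fin N) × EuclideanSpace ℝ (Fin N), u p.2 = v p.2 :=
    Measure.quasiMeasurePreserving_snd.ae h
  filter_upwards [h1, h2] with p h1 h2
  simp only [diffQuot, h1, h2]

lemma aestronglyMeasurable_diffQuot {u : EuclideanSpace ℝ (Fin N) → ℝ}
    (hu : AEStronglyMeasurable u volume) : AEStronglyMeasurable (diffQuot s u) volume := by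
  have h1 : AEStronglyMeasurable
      (fun p : EuclideanSpace ℝ (Fin N) × EuclideanSpace ℝ (Fin N) => u p.1) volume :=
    hu.comp_quasiMeasurePreserving Measure.quasiMeasurePreserving_fst
  have h2 : AEStronglyMeasurable
      (fun p : EuclideanSpace ℝ (Fin N) × EuclideanSpace ℝ (Fin N) => u p.2) volume :=
    hu.comp_quasiMeasurePreserving Measure.quasiMeasurePreserving_snd
  have h3 : Measurable (fun p : EuclideanSpace ℝ (Fin N) × EuclideanSpace ℝ (Fin N) =>
      (‖p.1 - p.2‖ ^ (((N : ℝ) + 2 * s) / 2))⁻¹) := by fun_prop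
  exact (h1.sub h2).mul h3.aestronglyMeasurable

/-- The function `x ↦ ∫ |u(x) - u(y)|² / |x - y|^(N + 2s) dy`. -/
noncomputable def gagliardoDensity (s : ℝ) (u : EuclideanSpace ℝ (Fin N) → ℝ)
    (x : EuclideanSpace ℝ (Fin N)) : ℝ≥0∞ :=
  ∫⁻ y, ‖diffQuot s u (x, y)‖ₑ ^ (2 : ℝ)

lemma lintegral_gagliardoDensity {u : EuclideanSpace ℝ (Fin N) → ℝ}
    (hu : AEStronglyMeasurable u volume) :
    ∫⁻ x, gagliardoDensity s u x = eGagliardo s u ^ (2 : ℝ) := by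
  rw [eGagliardo_eq_eLpNorm, eLpNorm_eq_lintegral_rpow_enorm_toReal (by norm_num) (by norm_num)]
  simp only [ENNReal.toReal_ofNat]
  rw [← ENNReal.rpow_mul, one_div, inv_mul_cancel₀ (by norm_num), ENNReal.rpow_one]
  simp only [gagliardoDensity]
  rw [Measure.volume_eq_prod, lintegral_prod]
  exact ((aestronglyMeasurable_diffQuot hu).enorm).pow_const _

/-! ### Ball averages and the fractional Sobolev inequality -/

lemma two_lt_critExp (hs0 : 0 < s) (hsN : 2 * s < N) : 2 < critExp N s := by
  have hN : (0 : ℝ) < N - 2 * s := by linarith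
  rw [critExp, lt_div_iff₀ hN]
  linarith

lemma enorm_average_le {α : Type*} [MeasurableSpace α] {μ : Measure α} {B : Set α} (hB0 : μ B ≠ 0)
    (hB : μ B ≠ ⊤) {f : α → ℝ} {q : ℝ} (hq : 1 ≤ q) (hf : AEStronglyMeasurable f (μ.restrict B)) :
    ‖⨍ y in B, f y ∂μ‖ₑ ≤ μ B ^ (-(1 / q)) * eLpNorm f (ENNReal.ofReal q) (μ.restrict B) := by
  have h1 : ‖⨍ y in B, f y ∂μ‖ₑ ≤ (μ B)⁻¹ * eLpNorm f 1 (μ.restrict B) := by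
    rw [setAverage_eq, enorm_smul, eLpNorm_one_eq_lintegral_enorm]
    gcongr
    · rw [Real.enorm_eq_ofReal (by positivity), measureReal_def, ENNReal.ofReal_inv_of_pos
        (ENNReal.toReal_pos hB0 hB), ENNReal.ofReal_toReal hB]
    · exact enorm_integral_le_lintegral_enorm _
  have h2 := eLpNorm_le_eLpNorm_mul_rpow_measure_univ (p := 1) (q := ENNReal.ofReal q)
    (by simpa using hq) hf
  rw [Measure.restrict_apply_univ, ENNReal.toReal_ofReal (by linarith), ENNReal.toReal_one] at h2
  refine h1.trans ((mul_le_mul_right h2 _).trans_eq ?_)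
  rw [mul_comm (eLpNorm _ _ _), ← mul_assoc, ← ENNReal.rpow_neg_one, ← ENNReal.rpow_add _ _ hB0 hB]
  congr 2
  ring

lemma integrableOn_ball_of_memLp {u : EuclideanSpace ℝ (Fin N) → ℝ} {q : ℝ≥0∞} (hq : 1 ≤ q)
    (hu : MemLp u q volume) (x : EuclideanSpace ℝ (Fin N)) (r : ℝ) :
    IntegrableOn u (Metric.ball x r) volume :=
  (hu.locallyIntegrable hq).integrableOn_isCompact (isCompact_closedBall x r) |>.mono_set
    Metric.ball_subset_closedBall

/-- The volume of the unit ball. -/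
noncomputable def unitVol (N : ℕ) : ℝ :=
  (volume (Metric.ball (0 : EuclideanSpace ℝ (Fin N)) 1)).toReal

lemma unitVol_pos (N : ℕ) : 0 < unitVol N :=
  ENNReal.toReal_pos (Metric.measure_ball_pos _ _ one_pos).ne' measure_ball_lt_top.ne

lemma volume_ball_eq (x : EuclideanSpace ℝ (Fin N)) {r : ℝ} (hr : 0 < r) :
    volume (Metric.ball x r) = ENNReal.ofReal (r ^ (N : ℝ) * unitVol N) := by
  rw [Measure.addHaar_ball_of_pos _ _ hr, finrank_euclideanSpace_fin, unitVol,
    ENNReal.ofReal_mul (by positivity), ENNReal.ofReal_toReal measure_ball_lt_top.ne,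
    Real.rpow_natCast]

/-- On the ball |x - y| < r, so |u(x) - u(y)| is at most r^{(N+2s)/2} times the difference quotient.
The L² bound for averages costs r^{-N/2}, leaving r^s. -/
lemma enorm_sub_average_le (hs0 : 0 < s) {u : EuclideanSpace ℝ (Fin N) → ℝ}
    (hu : AEStronglyMeasurable u volume)
    (x : EuclideanSpace ℝ (Fin N)) {r : ℝ} (hr : 0 < r) (hi : IntegrableOn u (Metric.ball x r)) :
    ‖u x - ⨍ y in Metric.ball x r, u y‖ₑ ≤
      ENNReal.ofReal (unitVol N ^ (-(1 / 2) : ℝ) * r ^ s) *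
        gagliardoDensity s u x ^ (1 / 2 : ℝ) := by
  have hb := unitVol_pos N
  have hB0 : volume (Metric.ball x r) ≠ 0 := (Metric.measure_ball_pos _ _ hr).ne'
  have hB : volume (Metric.ball x r) ≠ ⊤ := measure_ball_lt_top.ne
  have hav : u x - ⨍ y in Metric.ball x r, u y = ⨍ y in Metric.ball x r, (u x - u y) := by
    have hc : Integrable (fun _ => u x) (volume.restrict (Metric.ball x r)) :=
      integrableOn_const hB
    rw [setAverage_eq, setAverage_eq, integral_sub hc hi, setIntegral_const,
      smul_sub, smul_smul, inv_mul_cancel₀, one_smul]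
    exact (ENNReal.toReal_pos hB0 hB).ne'
  have hm : AEStronglyMeasurable (fun y => u x - u y) volume :=
    aestronglyMeasurable_const.sub hu
  rw [hav]
  refine (enorm_average_le hB0 hB (q := 2) (by norm_num) hm.restrict).trans ?_
  have hL2 : eLpNorm (fun y => u x - u y) (ENNReal.ofReal 2) (volume.restrict (Metric.ball x r)) ≤
      ENNReal.ofReal (r ^ (((N : ℝ) + 2 * s) / 2)) * gagliardoDensity s u x ^ (1 / 2 : ℝ) := by
    rw [show ENNReal.ofReal 2 = 2 by simp]
    rw [eLpNorm_eq_lintegral_rpow_enorm_toReal (by norm_num) (by norm_num)]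
    simp only [ENNReal.toReal_ofNat]
    have hsq : ENNReal.ofReal (r ^ (((N : ℝ) + 2 * s) / 2)) =
        (ENNReal.ofReal (r ^ (((N : ℝ) + 2 * s) / 2)) ^ (2 : ℝ)) ^ (1 / 2 : ℝ) := by
      rw [← ENNReal.rpow_mul]; norm_num
    rw [hsq, ← ENNReal.mul_rpow_of_nonneg _ _ (by norm_num)]
    gcongr
    rw [gagliardoDensity, ← lintegral_const_mul' _ _ (by simp)]
    refine (setLIntegral_mono_ae' measurableSet_ball ?_).trans (setLIntegral_le_lintegral _ _)
    refine .of_forall fun y hy => ?_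
    rw [← ENNReal.mul_rpow_of_nonneg _ _ (by norm_num)]
    gcongr
    by_cases hxy : x = y
    · simp [hxy]
    have hn : 0 < ‖x - y‖ := norm_pos_iff.2 (sub_ne_zero.2 hxy)
    have hpos := Real.rpow_pos_of_pos hn (((N : ℝ) + 2 * s) / 2)
    rw [Real.enorm_eq_ofReal_abs, Real.enorm_eq_ofReal_abs, ← ENNReal.ofReal_mul (by positivity)]
    apply ENNReal.ofReal_le_ofReal
    simp only [diffQuot]
    rw [abs_div, abs_of_pos hpos, ← mul_div_assoc, le_div_iff₀ hpos, mul_comm]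
    gcongr
    rw [Metric.mem_ball, dist_comm, dist_eq_norm] at hy
    exact hy.le
  refine (mul_le_mul_right hL2 _).trans_eq ?_
  rw [← mul_assoc, volume_ball_eq x hr, ENNReal.ofReal_rpow_of_pos (by positivity),
    ← ENNReal.ofReal_mul (by positivity)]
  congr 2
  rw [Real.mul_rpow (by positivity) hb.le, ← Real.rpow_mul hr.le, mul_comm, ← mul_assoc,
    ← Real.rpow_add hr, mul_comm]
  congr 2
  ring

/-- The power of r is N/p, which equals (N - 2s)/2 at the critical exponent p. -/
lemma enorm_average_le_critExp (hs0 : 0 < s) (hsN : 2 * s < N)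
    {u : EuclideanSpace ℝ (Fin N) → ℝ} (hu : AEStronglyMeasurable u volume)
    (x : EuclideanSpace ℝ (Fin N)) {r : ℝ} (hr : 0 < r) :
    ‖⨍ y in Metric.ball x r, u y‖ₑ ≤
      ENNReal.ofReal (unitVol N ^ (-(1 / critExp N s)) * r ^ (-(((N : ℝ) - 2 * s) / 2))) *
        eLpNorm u (ENNReal.ofReal (critExp N s)) volume := by
  have hb := unitVol_pos N
  have hp := two_lt_critExp hs0 hsN
  have hN : (0 : ℝ) < N := by linarith
  have hN' : (N : ℝ) - 2 * s ≠ 0 := by linarith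
  refine (enorm_average_le (Metric.measure_ball_pos _ _ hr).ne' measure_ball_lt_top.ne
    (q := critExp N s) (by linarith) hu.restrict).trans ?_
  refine (mul_le_mul_right (eLpNorm_mono_measure _ Measure.restrict_le_self) _).trans_eq ?_
  rw [volume_ball_eq x hr, ENNReal.ofReal_rpow_of_pos (by positivity)]
  congr 2
  rw [Real.mul_rpow (by positivity) hb.le, ← Real.rpow_mul hr.le, mul_comm]
  congr 2
  rw [critExp]
  field_simp

/-- The optimisation in the radius behind the pointwise estimate for the Sobolev inequality. -/
lemma rpow_critExp_le_of_forall_radius (hsN : 2 * s < N) {a A B M G : ℝ}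
    (ha : 0 < a) (hA : 0 < A) (hB : 0 < B) (hM : 0 < M)
    (h : ∀ r : ℝ, 0 < r → a ≤ A * r ^ s * G + B * r ^ (-(((N : ℝ) - 2 * s) / 2)) * M) :
    a ^ critExp N s ≤
      4 * A ^ 2 * (2 * B) ^ (critExp N s - 2) * M ^ (critExp N s - 2) * G ^ 2 := by
  set p := critExp N s with hp
  have hd : (0 : ℝ) < N - 2 * s := by linarith
  have hX : 0 < 2 * B * M / a := by positivity
  -- The radius at which the average term equals a/2. The other term then carries at least a/2;
  -- squaring and multiplying by a^{p-2} gives the claim.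
  have h1 := h ((2 * B * M / a) ^ (2 / ((N : ℝ) - 2 * s))) (by positivity)
  have hps : 2 / ((N : ℝ) - 2 * s) * s = (p - 2) / 2 := by
    rw [hp, critExp]; field_simp; ring
  rw [← Real.rpow_mul hX.le, ← Real.rpow_mul hX.le, hps,
    show 2 / ((N : ℝ) - 2 * s) * -(((N : ℝ) - 2 * s) / 2) = -1 by field_simp,
    Real.rpow_neg_one] at h1
  have h2 : B * (2 * B * M / a)⁻¹ * M = a / 2 := by field_simp
  rw [h2] at h1
  have h3 : a ≤ 2 * A * (2 * B * M / a) ^ ((p - 2) / 2) * G := by linarith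
  have h4 : a ^ 2 ≤ (2 * A * (2 * B * M / a) ^ ((p - 2) / 2) * G) ^ 2 := by gcongr
  have h5 : ((2 * B * M / a) ^ ((p - 2) / 2)) ^ 2 = (2 * B) ^ (p - 2) * M ^ (p - 2) / a ^ (p - 2) := by
    rw [← Real.rpow_mul_natCast hX.le, Real.div_rpow (by positivity) ha.le,
      Real.mul_rpow (by positivity) hM.le]
    norm_num
  have h6 : 0 < a ^ (p - 2) := by positivity
  rw [mul_pow, mul_pow, h5] at h4
  calc a ^ p = a ^ 2 * a ^ (p - 2) := by
        rw [← Real.rpow_two, ← Real.rpow_add ha]; congr 1; ring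
    _ ≤ _ := mul_le_mul_of_nonneg_right h4 h6.le
    _ = _ := by field_simp; ring

/-- The fractional Sobolev inequality. -/
theorem exists_eLpNorm_le_eGagliardo (hs0 : 0 < s) (hsN : 2 * s < N) :
    ∃ C : NNReal, ∀ u : EuclideanSpace ℝ (Fin N) → ℝ,
      MemLp u (ENNReal.ofReal (critExp N s)) volume →
      eLpNorm u (ENNReal.ofReal (critExp N s)) volume ≤ C * eGagliardo s u := by
  have hb := unitVol_pos N
  have hp := two_lt_critExp hs0 hsN
  set p := critExp N s with hpdef
  set A := unitVol N ^ (-(1 / 2) : ℝ)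
  set B := unitVol N ^ (-(1 / p))
  have hA : 0 < A := by positivity
  have hB : 0 < B := by positivity
  set D : ℝ := 4 * A ^ 2 * (2 * B) ^ (p - 2)
  have hD : 0 < D := by positivity
  refine ⟨(D ^ (1 / 2 : ℝ)).toNNReal, fun u hu => ?_⟩
  set M := eLpNorm u (ENNReal.ofReal p) volume with hMdef
  have hMt : M ≠ ⊤ := hu.2.ne
  by_cases hM0 : M = 0
  · simp [hM0]
  have hMpos : 0 < M.toReal := ENNReal.toReal_pos hM0 hMt
  -- Pointwise form of the inequality; only the square of G appears, so integration in x produces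
  -- the squared seminorm.
  have hpt : ∀ x, ‖u x‖ₑ ^ p ≤ ENNReal.ofReal (D * M.toReal ^ (p - 2)) * gagliardoDensity s u x := by
    intro x
    have hDM : 0 < D * M.toReal ^ (p - 2) := by positivity
    by_cases hg : gagliardoDensity s u x = ⊤
    · rw [hg, ENNReal.mul_top (by simpa using hDM)]
      exact le_top
    by_cases hux : u x = 0
    · rw [hux]; simp [show 0 < p by linarith]
    set G := (gagliardoDensity s u x ^ (1 / 2 : ℝ)).toReal with hG
    have hGt : gagliardoDensity s u x ^ (1 / 2 : ℝ) ≠ ⊤ :=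
      ENNReal.rpow_ne_top_of_nonneg (by norm_num) hg
    have key := rpow_critExp_le_of_forall_radius hsN (a := |u x|) (A := A) (B := B)
      (M := M.toReal) (G := G) (abs_pos.2 hux) hA hB hMpos (by
        intro r hr
        have hi := integrableOn_ball_of_memLp (by simp; linarith) hu x r
        have e1 := enorm_sub_average_le hs0 hu.1 x hr hi
        have e2 := enorm_average_le_critExp hs0 hsN hu.1 x hr
        rw [← ENNReal.ofReal_toReal hGt, ← ENNReal.ofReal_mul (by positivity),
          Real.enorm_eq_ofReal_abs, ENNReal.ofReal_le_ofReal_iff (by positivity)] at e1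
        rw [← hpdef, ← hMdef, ← ENNReal.ofReal_toReal hMt, ← ENNReal.ofReal_mul (by positivity),
          Real.enorm_eq_ofReal_abs, ENNReal.ofReal_le_ofReal_iff (by positivity)] at e2
        have e3 := abs_add_le (u x - ⨍ y in Metric.ball x r, u y) (⨍ y in Metric.ball x r, u y)
        rw [sub_add_cancel] at e3
        linarith)
    have hg2 : gagliardoDensity s u x = ENNReal.ofReal (G ^ 2) := by
      rw [ENNReal.ofReal_pow ENNReal.toReal_nonneg, ENNReal.ofReal_toReal hGt, ← ENNReal.rpow_two,
        ← ENNReal.rpow_mul]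
      norm_num
    rw [hg2, ← ENNReal.ofReal_mul hDM.le, Real.enorm_eq_ofReal_abs,
      ENNReal.ofReal_rpow_of_nonneg (abs_nonneg _) (by linarith)]
    exact ENNReal.ofReal_le_ofReal key
  have hint : M ^ p ≤ ENNReal.ofReal (D * M.toReal ^ (p - 2)) * eGagliardo s u ^ (2 : ℝ) := by
    rw [← lintegral_gagliardoDensity hu.1, ← lintegral_const_mul' _ _ (by simp)]
    have hMp : M ^ p = ∫⁻ x, ‖u x‖ₑ ^ p := by
      rw [hMdef, eLpNorm_eq_lintegral_rpow_enorm_toReal (by simp; linarith) (by simp),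
        ENNReal.toReal_ofReal (by linarith), ← ENNReal.rpow_mul, one_div,
        inv_mul_cancel₀ (by linarith), ENNReal.rpow_one]
    rw [hMp]
    exact lintegral_mono hpt
  -- Cancelling M^{p-2} requires M finite, which is where membership in L^p enters.
  have hM2 : M ^ (2 : ℝ) ≤ ENNReal.ofReal D * eGagliardo s u ^ (2 : ℝ) := by
    have hMp : M ^ (p - 2) ≠ 0 := by simp [hM0, hMt]
    have hMp' : M ^ (p - 2) ≠ ⊤ := ENNReal.rpow_ne_top_of_nonneg (by linarith) hMt
    rw [← ENNReal.mul_le_mul_iff_right hMp hMp', ← ENNReal.rpow_add _ _ hM0 hMt, sub_add_cancel,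
      ← mul_assoc]
    refine hint.trans_eq ?_
    rw [ENNReal.ofReal_mul hD.le, ← ENNReal.ofReal_rpow_of_pos hMpos, ENNReal.ofReal_toReal hMt,
      mul_comm (ENNReal.ofReal D)]
  have := ENNReal.rpow_le_rpow hM2 (z := 1 / 2) (by norm_num)
  rw [ENNReal.mul_rpow_of_nonneg _ _ (by norm_num), ← ENNReal.rpow_mul, ← ENNReal.rpow_mul,
    ENNReal.ofReal_rpow_of_pos hD] at this
  norm_num at this
  simpa [ENNReal.ofReal] using this

/-! ### Test functions have finite seminorm -/

/-- Near 0 the quadratic bound leaves |z|^{2-N-2s}, integrable because s < 1; at infinity the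
constant bound leaves |z|^{-N-2s}, integrable because s > 0. -/
lemma integrable_min_sq_div_rpow (hs0 : 0 < s) (hs1 : s < 1) (hN : 1 ≤ N) {c d : ℝ}
    (hc : 0 ≤ c) (hd : 0 ≤ d) :
    Integrable (fun z : EuclideanSpace ℝ (Fin N) =>
      min (c * ‖z‖ ^ 2) d / ‖z‖ ^ ((N : ℝ) + 2 * s)) volume := by
  have hm : Measurable (fun z : EuclideanSpace ℝ (Fin N) =>
      min (c * ‖z‖ ^ 2) d / ‖z‖ ^ ((N : ℝ) + 2 * s)) := by fun_prop
  have hnn : ∀ z : EuclideanSpace ℝ (Fin N),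
      0 ≤ min (c * ‖z‖ ^ 2) d / ‖z‖ ^ ((N : ℝ) + 2 * s) := fun z => by positivity
  rw [← integrableOn_univ, ← Set.union_compl_self (Metric.ball (0 : EuclideanSpace ℝ (Fin N)) 1),
    integrableOn_union]
  constructor
  · refine integrableOn_ball_of_norm_le_rpow (C := c) (α := N + 2 * s - 2) (by simpa using hN)
      (by simp; linarith) (.of_forall fun z => ?_) hm.aestronglyMeasurable
    rw [Real.norm_of_nonneg (hnn z)]
    rcases eq_or_ne z 0 with rfl | hz
    -- At the origin the kernel has denominator 0, and division by zero returns 0.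
    · have : (N : ℝ) + 2 * s ≠ 0 := by positivity
      simp only [norm_zero, Real.zero_rpow this, div_zero]
      positivity
    have hz' : 0 < ‖z‖ := norm_pos_iff.2 hz
    rw [div_le_iff₀ (by positivity), mul_assoc, ← Real.rpow_add hz',
      show -((N : ℝ) + 2 * s - 2) + (N + 2 * s) = 2 by ring, Real.rpow_two]
    exact min_le_left _ _
  · have hj := integrable_one_add_norm (E := EuclideanSpace ℝ (Fin N)) (μ := volume)
      (r := (N : ℝ) + 2 * s) (by simp; linarith)
    -- The factor 2^{N+2s} comes from 1 + |z| ≤ 2|z| outside the unit ball.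
    refine Integrable.mono' ((hj.const_mul (d * 2 ^ ((N : ℝ) + 2 * s))).integrableOn
      (s := (Metric.ball 0 1)ᶜ)) hm.aestronglyMeasurable ?_
    refine (ae_restrict_iff' measurableSet_ball.compl).2 (.of_forall fun z hz => ?_)
    have hz1 : 1 ≤ ‖z‖ := by simpa using hz
    rw [Real.norm_of_nonneg (hnn z), div_le_iff₀ (by positivity), Real.rpow_neg (by positivity),
      mul_assoc, mul_assoc, ← div_eq_inv_mul, ← mul_div_assoc,
      ← Real.mul_rpow (by norm_num) (by positivity)]
    refine (min_le_right _ _).trans (le_mul_of_one_le_right hd ?_)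
    rw [one_le_div (by positivity)]
    gcongr
    linarith

lemma lintegral_prod_sub_mul_left {g f : EuclideanSpace ℝ (Fin N) → ℝ≥0∞} (hg : Measurable g)
    (hf : Measurable f) :
    ∫⁻ p : EuclideanSpace ℝ (Fin N) × EuclideanSpace ℝ (Fin N), f p.1 * g (p.1 - p.2) =
      (∫⁻ x, f x) * ∫⁻ z, g z := by
  rw [Measure.volume_eq_prod, lintegral_prod _ (by fun_prop)]
  simp only
  calc _ = ∫⁻ x, f x * ∫⁻ z, g z := by
        refine lintegral_congr fun x => ?_
        rw [lintegral_const_mul _ (by fun_prop), lintegral_sub_left_eq_self g x]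
    _ = _ := lintegral_mul_const _ hf

lemma lintegral_prod_sub_mul_right {g f : EuclideanSpace ℝ (Fin N) → ℝ≥0∞} (hg : Measurable g)
    (hf : Measurable f) :
    ∫⁻ p : EuclideanSpace ℝ (Fin N) × EuclideanSpace ℝ (Fin N), f p.2 * g (p.1 - p.2) =
      (∫⁻ x, f x) * ∫⁻ z, g z := by
  rw [Measure.volume_eq_prod, lintegral_prod_symm _ (by fun_prop)]
  simp only
  calc _ = ∫⁻ x, f x * ∫⁻ z, g z := by
        refine lintegral_congr fun x => ?_
        rw [lintegral_const_mul _ (by fun_prop), lintegral_sub_right_eq_self g x]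
    _ = _ := lintegral_mul_const _ hf

/-- Smooth compactly supported functions have finite Gagliardo norm. -/
theorem eGagliardo_lt_top_of_contDiff (hs0 : 0 < s) (hs1 : s < 1) (hN : 1 ≤ N)
    {φ : EuclideanSpace ℝ (Fin N) → ℝ} (hφ : ContDiff ℝ ∞ φ) (hφc : HasCompactSupport φ) :
    eGagliardo s φ < ⊤ := by
  obtain ⟨L, hL⟩ := hφ.lipschitzWith_of_hasCompactSupport hφc (by simp)
  obtain ⟨M, hM⟩ := hφc.exists_bound_of_continuous hφ.continuous
  have hM0 : 0 ≤ M := (norm_nonneg _).trans (hM 0)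
  set K : EuclideanSpace ℝ (Fin N) → ℝ :=
    fun z => min ((L : ℝ) ^ 2 * ‖z‖ ^ 2) (4 * M ^ 2) / ‖z‖ ^ ((N : ℝ) + 2 * s) with hK
  have hKi : Integrable K volume :=
    integrable_min_sq_div_rpow hs0 hs1 hN (by positivity) (by positivity)
  have hKm : Measurable (fun z => ENNReal.ofReal (K z)) := by simp only [hK]; fun_prop
  set S := tsupport φ
  have hSm : MeasurableSet S := (isClosed_tsupport φ).measurableSet
  have hSf : volume S ≠ ⊤ := hφc.isCompact.measure_lt_top.ne
  set f : EuclideanSpace ℝ (Fin N) → ℝ≥0∞ := S.indicator 1 with hf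
  have hfm : Measurable f := measurable_one.indicator hSm
  have hfi : ∫⁻ x, f x ≠ ⊤ := by rwa [hf, lintegral_indicator_one hSm]
  have hKt : ∫⁻ z, ENNReal.ofReal (K z) ≠ ⊤ := hKi.lintegral_lt_top.ne
  -- The integrand vanishes unless one of the points lies in the support; elsewhere the Lipschitz
  -- bound and the sup bound together give the kernel `K`.
  have hb : ∀ p : EuclideanSpace ℝ (Fin N) × EuclideanSpace ℝ (Fin N),
      ENNReal.ofReal (|φ p.1 - φ p.2| ^ 2 / ‖p.1 - p.2‖ ^ ((N : ℝ) + 2 * s)) ≤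
        f p.1 * ENNReal.ofReal (K (p.1 - p.2)) + f p.2 * ENNReal.ofReal (K (p.1 - p.2)) := by
    rintro ⟨x, y⟩
    simp only
    have hle : ENNReal.ofReal (|φ x - φ y| ^ 2 / ‖x - y‖ ^ ((N : ℝ) + 2 * s)) ≤
        ENNReal.ofReal (K (x - y)) := by
      apply ENNReal.ofReal_le_ofReal
      simp only [hK]
      gcongr
      refine le_min ?_ ?_
      · have := hL.dist_le_mul x y
        rw [dist_eq_norm, dist_eq_norm, Real.norm_eq_abs] at this
        calc |φ x - φ y| ^ 2 ≤ (L * ‖x - y‖) ^ 2 := by gcongr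
          _ = _ := by ring
      · calc |φ x - φ y| ^ 2 ≤ (M + M) ^ 2 := by
              gcongr
              exact (abs_sub _ _).trans (add_le_add (hM x) (hM y))
          _ = _ := by ring
    by_cases hx : x ∈ S
    · refine hle.trans (le_add_right ?_)
      simp [hf, hx]
    by_cases hy : y ∈ S
    · refine hle.trans (le_add_left ?_)
      simp [hf, hy]
    simp [image_eq_zero_of_notMem_tsupport hx, image_eq_zero_of_notMem_tsupport hy]
  refine ENNReal.rpow_lt_top_of_nonneg (by norm_num) ?_
  refine ne_top_of_le_ne_top ?_ (lintegral_mono hb)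
  rw [lintegral_add_left (by fun_prop), lintegral_prod_sub_mul_left hKm hfm,
    lintegral_prod_sub_mul_right hKm hfm]
  exact ENNReal.add_ne_top.2 ⟨ENNReal.mul_ne_top hfi hKt, ENNReal.mul_ne_top hfi hKt⟩

/-! ### Linear structure of D^s -/

lemma MemDs.of_contDiff
    {φ : EuclideanSpace ℝ (Fin N) → ℝ} (hφ : ContDiff ℝ ∞ φ) (hφc : HasCompactSupport φ) :
    MemDs s φ := by
  refine ⟨hφ.continuous.memLp_of_hasCompactSupport hφc, fun _ => φ, fun _ => ⟨hφ, hφc⟩, ?_, ?_⟩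
  · simp [eGagliardo]
  · simp

/-- Finiteness of the seminorm is inherited from an approximant: u = φ_n - (φ_n - u), where both
terms have finite seminorm for large n. -/
lemma MemDs.memLp_diffQuot (hs0 : 0 < s) (hs1 : s < 1) (hsN : 2 * s < N)
    {u : EuclideanSpace ℝ (Fin N) → ℝ} (hu : MemDs s u) : MemLp (diffQuot s u) 2 volume := by
  have hN : 1 ≤ N := by
    have : (0 : ℝ) < N := by linarith
    exact_mod_cast this
  obtain ⟨hup, φ, hφ, hφg, -⟩ := hu
  obtain ⟨n, hn⟩ := (hφg.eventually (gt_mem_nhds ENNReal.zero_lt_top)).exists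
  have h1 : MemLp (diffQuot s (fun x => φ n x - u x)) 2 volume :=
    ⟨aestronglyMeasurable_diffQuot ((hφ n).1.continuous.aestronglyMeasurable.sub hup.1), by
      rwa [← eGagliardo_eq_eLpNorm]⟩
  have h2 : MemLp (diffQuot s (φ n)) 2 volume :=
    ⟨aestronglyMeasurable_diffQuot (hφ n).1.continuous.aestronglyMeasurable, by
      rw [← eGagliardo_eq_eLpNorm]
      exact eGagliardo_lt_top_of_contDiff hs0 hs1 hN (hφ n).1 (hφ n).2⟩
  have h3 := h2.sub h1
  rw [diffQuot_sub, sub_sub_cancel] at h3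
  exact h3

/-- This one form serves sums, multiples (with u = 0) and the curves t ↦ u + tφ of the first
variation. -/
lemma MemDs.add_const_mul (hs0 : 0 < s) (hsN : 2 * s < N) {u v : EuclideanSpace ℝ (Fin N) → ℝ}
    (hu : MemDs s u) (hv : MemDs s v) (c : ℝ) : MemDs s (fun x => u x + c * v x) := by
  have hp := two_lt_critExp hs0 hsN
  obtain ⟨hup, φ, hφ, hφg, hφp⟩ := hu
  obtain ⟨hvp, ψ, hψ, hψg, hψp⟩ := hv
  have hsub : ∀ n, (fun x => φ n x + c * ψ n x - (u x + c * v x)) =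
      (fun x => φ n x - u x) + c • (fun x => ψ n x - v x) := by
    intro n; ext x; simp only [Pi.add_apply, Pi.smul_apply, smul_eq_mul]; ring
  have hφm : ∀ n, AEStronglyMeasurable (fun x => φ n x - u x) volume := fun n =>
    (hφ n).1.continuous.aestronglyMeasurable.sub hup.1
  have hψm : ∀ n, AEStronglyMeasurable (fun x => ψ n x - v x) volume := fun n =>
    (hψ n).1.continuous.aestronglyMeasurable.sub hvp.1
  have hzero : ∀ {a b : ℕ → ℝ≥0∞}, Tendsto a atTop (𝓝 0) → Tendsto b atTop (𝓝 0) →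
      Tendsto (fun n => a n + ‖c‖ₑ * b n) atTop (𝓝 0) := fun ha hb => by
    simpa using ha.add (ENNReal.Tendsto.const_mul hb (Or.inr enorm_ne_top))
  refine ⟨hup.add (hvp.const_mul c), fun n x => φ n x + c * ψ n x, fun n => ⟨?_, ?_⟩, ?_, ?_⟩
  · exact (hφ n).1.add (contDiff_const.mul (hψ n).1)
  · exact (hφ n).2.add ((hψ n).2.mul_left (f := fun _ => c))
  · refine tendsto_of_tendsto_of_tendsto_of_le_of_le tendsto_const_nhds (hzero hφg hψg)
      (fun _ => zero_le) fun n => ?_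
    simp only [hsub, eGagliardo_eq_eLpNorm]
    have : diffQuot s ((fun x => φ n x - u x) + c • (fun x => ψ n x - v x)) =
        diffQuot s (fun x => φ n x - u x) + c • diffQuot s (fun x => ψ n x - v x) := by
      rw [← diffQuot_const_mul, ← diffQuot_add]; rfl
    rw [this]
    refine (eLpNorm_add_le (aestronglyMeasurable_diffQuot (hφm n))
      ((aestronglyMeasurable_diffQuot (hψm n)).const_smul c) (by norm_num)).trans ?_
    rw [eLpNorm_const_smul]
  · refine tendsto_of_tendsto_of_tendsto_of_le_of_le tendsto_const_nhds (hzero hφp hψp)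
      (fun _ => zero_le) fun n => ?_
    simp only [hsub]
    refine (eLpNorm_add_le (hφm n) ((hψm n).const_smul c) ?_).trans ?_
    · simp; linarith
    rw [eLpNorm_const_smul]

lemma memDs_zero : MemDs s (0 : EuclideanSpace ℝ (Fin N) → ℝ) :=
  ⟨MemLp.zero, fun _ => 0, fun _ => ⟨contDiff_const, HasCompactSupport.zero⟩, by simp [eGagliardo],
    by simp⟩

/-! ### Weak compactness in D^s, tested on ball averages -/

/-- Sequential Banach–Alaoglu in the dual of a separable space, moved to H by the Riesz isometry. -/
lemma exists_subseq_weak_tendsto {H : Type*} [NormedAddCommGroup H] [InnerProductSpace ℝ H]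
    [CompleteSpace H] [TopologicalSpace.SeparableSpace H] {z : ℕ → H} {R : ℝ}
    (hz : ∀ n, ‖z n‖ ≤ R) :
    ∃ (z₀ : H) (σ : ℕ → ℕ), StrictMono σ ∧
      ∀ l : H →L[ℝ] ℝ, Tendsto (fun n => l (z (σ n))) atTop (𝓝 (l z₀)) := by
  have hc := WeakDual.isSeqCompact_closedBall ℝ H 0 R
  obtain ⟨a, -, σ, hσ, ha⟩ := hc (x := fun n => StrongDual.toWeakDual
    (InnerProductSpace.toDual ℝ H (z n))) (fun n => by
      simp only [Set.mem_preimage, mem_closedBall_zero_iff]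
      refine le_trans (le_of_eq ?_) (hz n)
      exact (InnerProductSpace.toDual ℝ H).norm_map (z n))
  refine ⟨(InnerProductSpace.toDual ℝ H).symm (WeakDual.toStrongDual a), σ, hσ, fun l => ?_⟩
  obtain ⟨y, rfl⟩ := (InnerProductSpace.toDual ℝ H).surjective l
  have h := (WeakDual.eval_continuous (𝕜 := ℝ) (E := H) y).continuousAt.tendsto.comp ha
  simp only [InnerProductSpace.toDual_apply_apply]
  rw [real_inner_comm, InnerProductSpace.toDual_symm_apply]
  refine Tendsto.congr (fun n => ?_) h
  simp only [Function.comp_apply]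
  rw [real_inner_comm]
  rfl

/-- Difference quotients do not see additive constants; the Sobolev inequality for u - v rules these
out. -/
lemma ae_eq_of_diffQuot_ae_eq (hs0 : 0 < s) (hsN : 2 * s < N)
    {u v : EuclideanSpace ℝ (Fin N) → ℝ} (hu : MemDs s u) (hv : MemDs s v)
    (h : diffQuot s u =ᵐ[volume] diffQuot s v) : u =ᵐ[volume] v := by
  have hp := two_lt_critExp hs0 hsN
  obtain ⟨C, hC⟩ := exists_eLpNorm_le_eGagliardo hs0 hsN
  have h1 := hC (fun x => u x - v x) (hu.1.sub hv.1)
  have h0 : eGagliardo s (fun x => u x - v x) = 0 := by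
    rw [eGagliardo_eq_eLpNorm, diffQuot_sub]
    have : diffQuot s u - diffQuot s v =ᵐ[volume] 0 := by
      filter_upwards [h] with p hp
      simp [hp]
    rw [eLpNorm_congr_ae this, eLpNorm_zero]
  have hm : AEStronglyMeasurable (fun x => u x - v x) volume := hu.1.1.sub hv.1.1
  rw [h0, mul_zero, nonpos_iff_eq_zero, eLpNorm_eq_zero_iff hm (by simp; linarith)] at h1
  filter_upwards [h1] with x hx
  exact sub_eq_zero.1 hx

/-- A diagonal argument: u_n is replaced by a test function within 1/(n+1) of it in both norms. -/
lemma memDs_of_tendsto (hs0 : 0 < s) (hsN : 2 * s < N)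
    {u : ℕ → EuclideanSpace ℝ (Fin N) → ℝ} {v : EuclideanSpace ℝ (Fin N) → ℝ}
    (hu : ∀ n, MemDs s (u n)) (hv : MemLp v (ENNReal.ofReal (critExp N s)) volume)
    (hg : Tendsto (fun n => eGagliardo s (fun x => u n x - v x)) atTop (𝓝 0))
    (hL : Tendsto (fun n => eLpNorm (fun x => u n x - v x) (ENNReal.ofReal (critExp N s)) volume)
      atTop (𝓝 0)) : MemDs s v := by
  have hp := two_lt_critExp hs0 hsN
  have hex : ∀ n : ℕ, ∃ φ : EuclideanSpace ℝ (Fin N) → ℝ, ContDiff ℝ ∞ φ ∧ HasCompactSupport φ ∧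
      eGagliardo s (fun x => φ x - u n x) < ((n : ℝ≥0∞) + 1)⁻¹ ∧
      eLpNorm (fun x => φ x - u n x) (ENNReal.ofReal (critExp N s)) volume
        < ((n : ℝ≥0∞) + 1)⁻¹ := by
    intro n
    obtain ⟨-, φ, hφ, hφg, hφp⟩ := hu n
    have hpos : (0 : ℝ≥0∞) < ((n : ℝ≥0∞) + 1)⁻¹ := by simp
    obtain ⟨k, hk1, hk2⟩ := ((hφg.eventually (gt_mem_nhds hpos)).and
      (hφp.eventually (gt_mem_nhds hpos))).exists
    exact ⟨φ k, (hφ k).1, (hφ k).2, hk1, hk2⟩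
  choose φ hφ1 hφ2 hφ3 hφ4 using hex
  have hinv : Tendsto (fun n : ℕ => ((n : ℝ≥0∞) + 1)⁻¹) atTop (𝓝 0) := by
    have := (tendsto_add_atTop_iff_nat 1).2 ENNReal.tendsto_inv_nat_nhds_zero
    simpa using this
  have hsub : ∀ n, (fun x => φ n x - v x) = (fun x => (φ n x - u n x) + (u n x - v x)) := by
    intro n; ext x; ring
  have hφm : ∀ n, AEStronglyMeasurable (fun x => φ n x - u n x) volume := fun n =>
    (hφ1 n).continuous.aestronglyMeasurable.sub (hu n).1.1
  have hum : ∀ n, AEStronglyMeasurable (fun x => u n x - v x) volume := fun n =>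
    (hu n).1.1.sub hv.1
  refine ⟨hv, φ, fun n => ⟨hφ1 n, hφ2 n⟩, ?_, ?_⟩
  · refine tendsto_of_tendsto_of_tendsto_of_le_of_le tendsto_const_nhds
      (by simpa using hinv.add hg) (fun _ => zero_le) fun n => ?_
    simp only [hsub]
    rw [eGagliardo_eq_eLpNorm, diffQuot_add]
    refine (eLpNorm_add_le (aestronglyMeasurable_diffQuot (hφm n))
      (aestronglyMeasurable_diffQuot (hum n)) (by norm_num)).trans ?_
    rw [← eGagliardo_eq_eLpNorm, ← eGagliardo_eq_eLpNorm]
    exact add_le_add_left (hφ3 n).le _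
  · refine tendsto_of_tendsto_of_tendsto_of_le_of_le tendsto_const_nhds
      (by simpa using hinv.add hL) (fun _ => zero_le) fun n => ?_
    simp only [hsub]
    refine (eLpNorm_add_le (hφm n) (hum n) (by simp; linarith)).trans ?_
    exact add_le_add_left (hφ4 n).le _

/-- The image of `D^s(ℝ^N)` in `L²(ℝ^N × ℝ^N)` under the difference quotient. -/
noncomputable def quotSpace (N : ℕ) (s : ℝ) (hs0 : 0 < s) (hsN : 2 * s < N) :
    Submodule ℝ (Lp ℝ 2 (volume : Measure (EuclideanSpace ℝ (Fin N) × EuclideanSpace ℝ (Fin N))))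
    where
  carrier := {z | ∃ u : EuclideanSpace ℝ (Fin N) → ℝ, MemDs s u ∧ z =ᵐ[volume] diffQuot s u}
  zero_mem' := ⟨0, memDs_zero, by
    filter_upwards [Lp.coeFn_zero ℝ 2
      (volume : Measure (EuclideanSpace ℝ (Fin N) × EuclideanSpace ℝ (Fin N)))] with p hp
    rw [hp]; simp [diffQuot]⟩
  add_mem' := by
    rintro a b ⟨u, hu, hau⟩ ⟨v, hv, hbv⟩
    refine ⟨fun x => u x + v x, by simpa using hu.add_const_mul hs0 hsN hv 1, ?_⟩
    filter_upwards [Lp.coeFn_add a b, hau, hbv] with p h1 h2 h3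
    rw [h1, diffQuot_add, Pi.add_apply, Pi.add_apply, h2, h3]
  smul_mem' := by
    rintro c a ⟨u, hu, hau⟩
    refine ⟨fun x => c * u x, by simpa using memDs_zero.add_const_mul hs0 hsN hu c, ?_⟩
    filter_upwards [Lp.coeFn_smul c a, hau] with p h1 h2
    rw [h1, diffQuot_const_mul, Pi.smul_apply, Pi.smul_apply, h2]

/-- By the Sobolev inequality, convergence of the difference quotients in L² makes the functions
Cauchy in L^p; their limit is the candidate preimage. -/
lemma isClosed_quotSpace (hs0 : 0 < s) (hsN : 2 * s < N) :
    IsClosed (quotSpace N s hs0 hsN : Set (Lp ℝ 2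
      (volume : Measure (EuclideanSpace ℝ (Fin N) × EuclideanSpace ℝ (Fin N))))) := by
  have hp := two_lt_critExp hs0 hsN
  have : Fact (1 ≤ ENNReal.ofReal (critExp N s)) := ⟨by simp; linarith⟩
  refine IsSeqClosed.isClosed fun z z₀ hz hz₀ => ?_
  choose u hu hzu using hz
  obtain ⟨C, hC⟩ := exists_eLpNorm_le_eGagliardo hs0 hsN
  set U : ℕ → Lp ℝ (ENNReal.ofReal (critExp N s)) volume := fun n => (hu n).1.toLp (u n) with hU
  have hdist : ∀ n m, dist (U n) (U m) ≤ C * dist (z n) (z m) := by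
    intro n m
    rw [dist_eq_norm, dist_eq_norm, hU]
    simp only
    rw [← MemLp.toLp_sub, Lp.norm_toLp, Lp.norm_def]
    have h1 := hC (u n - u m) ((hu n).1.sub (hu m).1)
    have h2 : eGagliardo s (u n - u m) = eLpNorm (⇑(z n - z m)) 2 volume := by
      rw [eGagliardo_eq_eLpNorm]
      refine eLpNorm_congr_ae ?_
      filter_upwards [Lp.coeFn_sub (z n) (z m), hzu n, hzu m] with p h1 h2 h3
      rw [h1, Pi.sub_apply, h2, h3, ← Pi.sub_apply, ← diffQuot_sub]
      rfl
    rw [h2] at h1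
    have h3 := ENNReal.toReal_mono (ENNReal.mul_ne_top ENNReal.coe_ne_top (Lp.eLpNorm_ne_top _)) h1
    rwa [ENNReal.toReal_mul, ENNReal.coe_toReal] at h3
  have hcau : CauchySeq U := by
    have hzc := hz₀.cauchySeq
    rw [Metric.cauchySeq_iff'] at hzc ⊢
    intro ε hε
    obtain ⟨n₀, hn₀⟩ := hzc (ε / (C + 1)) (by positivity)
    refine ⟨n₀, fun n hn => (hdist n n₀).trans_lt ?_⟩
    have h1 := hn₀ n hn
    rw [lt_div_iff₀ (by positivity)] at h1
    have h2 : 0 ≤ dist (z n) (z n₀) := dist_nonneg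
    linarith
  obtain ⟨v, hv⟩ := cauchySeq_tendsto_of_complete hcau
  have hvL : Tendsto (fun n => eLpNorm (fun x => u n x - v x) (ENNReal.ofReal (critExp N s)) volume)
      atTop (𝓝 0) := by
    rw [Lp.tendsto_Lp_iff_tendsto_eLpNorm'] at hv
    refine hv.congr fun n => eLpNorm_congr_ae ?_
    filter_upwards [(hu n).1.coeFn_toLp] with x hx
    simp [hU, hx]
  have hzL : Tendsto (fun n => eLpNorm (diffQuot s (u n) - ⇑z₀) 2 volume) atTop (𝓝 0) := by
    rw [Lp.tendsto_Lp_iff_tendsto_eLpNorm'] at hz₀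
    refine hz₀.congr fun n => eLpNorm_congr_ae ?_
    filter_upwards [hzu n] with x hx
    simp [hx]
  -- Two successive subsequences give a.e. convergence of the functions and then of their quotients,
  -- so the limits must agree.
  have hvz : diffQuot s v =ᵐ[volume] z₀ := by
    obtain ⟨σ, hσ, hσv⟩ := (tendstoInMeasure_of_tendsto_eLpNorm (by simp; linarith)
      (fun n => (hu n).1.1) (Lp.aestronglyMeasurable v) hvL).exists_seq_tendsto_ae
    have hzσ := hzL.comp hσ.tendsto_atTop
    obtain ⟨ρ, hρ, hρz⟩ := (tendstoInMeasure_of_tendsto_eLpNorm (by norm_num)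
      (fun n => aestronglyMeasurable_diffQuot (hu (σ n)).1.1) (Lp.aestronglyMeasurable z₀)
      hzσ).exists_seq_tendsto_ae
    have h1 : ∀ᵐ p : EuclideanSpace ℝ (Fin N) × EuclideanSpace ℝ (Fin N),
        Tendsto (fun n => u (σ n) p.1) atTop (𝓝 (v p.1)) :=
      Measure.quasiMeasurePreserving_fst.ae hσv
    have h2 : ∀ᵐ p : EuclideanSpace ℝ (Fin N) × EuclideanSpace ℝ (Fin N),
        Tendsto (fun n => u (σ n) p.2) atTop (𝓝 (v p.2)) :=
      Measure.quasiMeasurePreserving_snd.ae hσv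
    filter_upwards [hρz, h1, h2] with p h3 h4 h5
    refine tendsto_nhds_unique ?_ h3
    exact (((h4.sub h5).div_const _).comp hρ.tendsto_atTop)
  refine ⟨v, memDs_of_tendsto hs0 hsN hu (Lp.memLp v) ?_ hvL, hvz.symm⟩
  refine hzL.congr fun n => ?_
  rw [eGagliardo_eq_eLpNorm, diffQuot_sub]
  refine eLpNorm_congr_ae ?_
  filter_upwards [hvz] with p hp
  simp [hp]

/-- A function in `D^s(ℝ^N)` with the given difference quotient. -/
noncomputable def quotSpaceRep (hs0 : 0 < s) (hsN : 2 * s < N) (z : quotSpace N s hs0 hsN) :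
    EuclideanSpace ℝ (Fin N) → ℝ := z.2.choose

lemma memDs_quotSpaceRep (hs0 : 0 < s) (hsN : 2 * s < N) (z : quotSpace N s hs0 hsN) :
    MemDs s (quotSpaceRep hs0 hsN z) := z.2.choose_spec.1

lemma diffQuot_quotSpaceRep (hs0 : 0 < s) (hsN : 2 * s < N) (z : quotSpace N s hs0 hsN) :
    z.1 =ᵐ[volume] diffQuot s (quotSpaceRep hs0 hsN z) := z.2.choose_spec.2

/-- Representatives are picked by choice, so linearity is available only through a.e. uniqueness. -/
lemma quotSpaceRep_add_smul (hs0 : 0 < s) (hsN : 2 * s < N) (a b : quotSpace N s hs0 hsN) (c : ℝ) :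
    quotSpaceRep hs0 hsN (a + c • b) =ᵐ[volume]
      fun x => quotSpaceRep hs0 hsN a x + c * quotSpaceRep hs0 hsN b x := by
  refine ae_eq_of_diffQuot_ae_eq hs0 hsN (memDs_quotSpaceRep hs0 hsN _)
    ((memDs_quotSpaceRep hs0 hsN a).add_const_mul hs0 hsN (memDs_quotSpaceRep hs0 hsN b) c) ?_
  rw [diffQuot_add, diffQuot_const_mul]
  filter_upwards [diffQuot_quotSpaceRep hs0 hsN (a + c • b), diffQuot_quotSpaceRep hs0 hsN a,
    diffQuot_quotSpaceRep hs0 hsN b, Lp.coeFn_add a.1 (c • b.1), Lp.coeFn_smul c b.1]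
    with p h1 h2 h3 h4 h5
  rw [← h1, Pi.add_apply, Pi.smul_apply, ← h2, ← h3]
  simp only [Submodule.coe_add, Submodule.coe_smul]
  rw [h4, Pi.add_apply, h5, Pi.smul_apply]

/-- The average over a ball is a continuous functional on `D^s(ℝ^N)`. -/
lemma exists_average_clm (hs0 : 0 < s) (hsN : 2 * s < N) (x : EuclideanSpace ℝ (Fin N)) {r : ℝ}
    (hr : 0 < r) : ∃ l : quotSpace N s hs0 hsN →L[ℝ] ℝ,
      ∀ z, l z = ⨍ y in Metric.ball x r, quotSpaceRep hs0 hsN z y := by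
  have hp := two_lt_critExp hs0 hsN
  obtain ⟨C, hC⟩ := exists_eLpNorm_le_eGagliardo hs0 hsN
  have hlin : ∀ (a b : quotSpace N s hs0 hsN) (c : ℝ),
      ⨍ y in Metric.ball x r, quotSpaceRep hs0 hsN (a + c • b) y =
      (⨍ y in Metric.ball x r, quotSpaceRep hs0 hsN a y) +
        c * ⨍ y in Metric.ball x r, quotSpaceRep hs0 hsN b y := by
    intro a b c
    have ha := integrableOn_ball_of_memLp (by simp; linarith) (memDs_quotSpaceRep hs0 hsN a).1 x r
    have hb := integrableOn_ball_of_memLp (by simp; linarith) (memDs_quotSpaceRep hs0 hsN b).1 x r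
    simp only [setAverage_eq, smul_eq_mul]
    rw [integral_congr_ae (ae_restrict_of_ae (quotSpaceRep_add_smul hs0 hsN a b c)),
      integral_add ha (hb.const_mul c), integral_const_mul]
    ring
  -- The representative of 0 need not be literally 0; additivity at 0 + 0 gives the vanishing of its
  -- average.
  have h0 : ⨍ y in Metric.ball x r, quotSpaceRep hs0 hsN 0 y = 0 := by
    have := hlin 0 0 1
    simp only [smul_zero, add_zero, one_mul] at this
    linarith
  refine ⟨LinearMap.mkContinuous
    { toFun := fun z => ⨍ y in Metric.ball x r, quotSpaceRep hs0 hsN z y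
      map_add' := fun a b => by simpa using hlin a b 1
      map_smul' := fun c a => by simpa [h0] using hlin 0 a c }
    (unitVol N ^ (-(1 / critExp N s)) * r ^ (-(((N : ℝ) - 2 * s) / 2)) * C) (fun z => ?_),
    fun z => rfl⟩
  have hb := unitVol_pos N
  have e1 := enorm_average_le_critExp hs0 hsN (memDs_quotSpaceRep hs0 hsN z).1.1 x hr
  have e2 := e1.trans (mul_le_mul_right (hC _ (memDs_quotSpaceRep hs0 hsN z).1) _)
  rw [eGagliardo_eq_eLpNorm, ← eLpNorm_congr_ae (diffQuot_quotSpaceRep hs0 hsN z)] at e2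
  have e3 := ENNReal.toReal_mono (ENNReal.mul_ne_top ENNReal.ofReal_ne_top
    (ENNReal.mul_ne_top ENNReal.coe_ne_top (Lp.eLpNorm_ne_top _))) e2
  rw [ENNReal.toReal_mul, ENNReal.toReal_mul, ENNReal.coe_toReal, toReal_enorm,
    ENNReal.toReal_ofReal (by positivity), ← mul_assoc, ← Lp.norm_def] at e3
  exact e3

/-- A bounded sequence in `D^s(ℝ^N)` has a subsequence whose averages over balls converge to those
of an element of `D^s(ℝ^N)`. -/
theorem exists_subseq_tendsto_average (hs0 : 0 < s) (hs1 : s < 1) (hsN : 2 * s < N)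
    {u : ℕ → EuclideanSpace ℝ (Fin N) → ℝ} (hu : ∀ n, MemDs s (u n)) {R : ℝ}
    (hR : ∀ n, eGagliardo s (u n) ≤ ENNReal.ofReal R) :
    ∃ (v : EuclideanSpace ℝ (Fin N) → ℝ) (σ : ℕ → ℕ), MemDs s v ∧ StrictMono σ ∧
      ∀ (x : EuclideanSpace ℝ (Fin N)) (r : ℝ), 0 < r →
        Tendsto (fun n => ⨍ y in Metric.ball x r, u (σ n) y) atTop
          (𝓝 (⨍ y in Metric.ball x r, v y)) := by
  have : CompleteSpace (quotSpace N s hs0 hsN) :=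
    (isClosed_quotSpace hs0 hsN).completeSpace_coe
  have : Fact ((2 : ℝ≥0∞) ≠ ⊤) := ⟨by norm_num⟩
  have : MeasureTheory.IsSeparable
      (volume : Measure (EuclideanSpace ℝ (Fin N) × EuclideanSpace ℝ (Fin N))) := by
    have hσ : SFinite
      (volume : Measure (EuclideanSpace ℝ (Fin N) × EuclideanSpace ℝ (Fin N))) := inferInstance
    exact @instIsSeparableOfCountablyGeneratedOfSFinite _ _ volume inferInstance hσ
  have : SecondCountableTopology (Lp ℝ 2
    (volume : Measure (EuclideanSpace ℝ (Fin N) × EuclideanSpace ℝ (Fin N)))) :=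
    Lp.SecondCountableTopology
  have : SecondCountableTopology (quotSpace N s hs0 hsN) :=
    TopologicalSpace.Subtype.secondCountableTopology _
  have : TopologicalSpace.SeparableSpace (quotSpace N s hs0 hsN) :=
    TopologicalSpace.SecondCountableTopology.to_separableSpace
  set z : ℕ → quotSpace N s hs0 hsN := fun n =>
    ⟨((hu n).memLp_diffQuot hs0 hs1 hsN).toLp, u n, hu n, MemLp.coeFn_toLp _⟩ with hz
  have hzn : ∀ n, ‖z n‖ ≤ max R 0 := by
    intro n
    rw [Submodule.coe_norm, hz]
    simp only
    rw [Lp.norm_toLp, ← eGagliardo_eq_eLpNorm]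
    refine ENNReal.toReal_le_of_le_ofReal (le_max_right _ _) ((hR n).trans ?_)
    exact ENNReal.ofReal_le_ofReal (le_max_left _ _)
  obtain ⟨z₀, σ, hσ, hw⟩ := exists_subseq_weak_tendsto hzn
  refine ⟨quotSpaceRep hs0 hsN z₀, σ, memDs_quotSpaceRep hs0 hsN z₀, hσ, fun x r hr => ?_⟩
  obtain ⟨l, hl⟩ := exists_average_clm hs0 hsN x hr
  have := hw l
  simp only [hl] at this
  refine this.congr fun n => ?_
  have hae : quotSpaceRep hs0 hsN (z (σ n)) =ᵐ[volume] u (σ n) := by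
    refine ae_eq_of_diffQuot_ae_eq hs0 hsN (memDs_quotSpaceRep hs0 hsN _) (hu _) ?_
    exact (diffQuot_quotSpaceRep hs0 hsN _).symm.trans
      (MemLp.coeFn_toLp ((hu (σ n)).memLp_diffQuot hs0 hs1 hsN))
  simp only [setAverage_eq]
  rw [integral_congr_ae (ae_restrict_of_ae hae)]

/-! ### From convergence of averages to convergence almost everywhere -/

/-- The ball volume does not depend on x, so this is a constant times a parametric integral against
the indicator of |y - x| < r. -/
lemma aestronglyMeasurable_average {v : EuclideanSpace ℝ (Fin N) → ℝ}
    (hv : AEStronglyMeasurable v volume) (r : ℝ) :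
    AEStronglyMeasurable (fun x => ⨍ y in Metric.ball x r, v y) volume := by
  have hS : MeasurableSet {p : EuclideanSpace ℝ (Fin N) × EuclideanSpace ℝ (Fin N) |
      dist p.2 p.1 < r} := measurableSet_lt (by fun_prop) measurable_const
  have h2 : AEStronglyMeasurable
      (fun p : EuclideanSpace ℝ (Fin N) × EuclideanSpace ℝ (Fin N) => v p.2)
      (volume.prod volume) :=
    hv.comp_quasiMeasurePreserving Measure.quasiMeasurePreserving_snd
  have h3 := (h2.indicator hS).integral_prod_right'
  have h4 := h3.const_smul (volume.real (Metric.ball (0 : EuclideanSpace ℝ (Fin N)) r))⁻¹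
  refine h4.congr (.of_forall fun x => ?_)
  simp only [Pi.smul_apply, setAverage_eq]
  rw [measureReal_def, measureReal_def, Measure.addHaar_ball_center _ x,
    ← integral_indicator measurableSet_ball]
  rfl

/-- The substitute for Rellich: the error is of order r^s, uniformly over sets bounded in the
seminorm. -/
lemma eLpNorm_sub_average_le (hs0 : 0 < s) {u : EuclideanSpace ℝ (Fin N) → ℝ} {q : ℝ≥0∞}
    (hq : 1 ≤ q) (hu : MemLp u q volume) {r : ℝ} (hr : 0 < r) :
    eLpNorm (fun x => u x - ⨍ y in Metric.ball x r, u y) 2 volume ≤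
      ENNReal.ofReal (unitVol N ^ (-(1 / 2) : ℝ) * r ^ s) * eGagliardo s u := by
  rw [eLpNorm_eq_lintegral_rpow_enorm_toReal (by norm_num) (by norm_num), ENNReal.toReal_ofNat,
    one_div, ENNReal.rpow_inv_le_iff (by norm_num), ENNReal.mul_rpow_of_nonneg _ _ (by norm_num),
    ← lintegral_gagliardoDensity hu.1,
    ← lintegral_const_mul' _ _ (ENNReal.rpow_ne_top_of_nonneg (by norm_num) ENNReal.ofReal_ne_top)]
  refine lintegral_mono fun x => ?_
  have h := ENNReal.rpow_le_rpow (z := 2) (enorm_sub_average_le hs0 hu.1 x hr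
    (integrableOn_ball_of_memLp hq hu x r)) (by norm_num)
  rw [ENNReal.mul_rpow_of_nonneg _ _ (by norm_num), ← ENNReal.rpow_mul _ (1 / 2)] at h
  simpa using h

/-- Averages are bounded uniformly in x but not dominated on the whole space, so a finite measure is
used. Truncating the density at 1 keeps L² bounds valid; positivity of the density transfers a.e.
statements back. -/
lemma exists_finite_measure_le {α : Type*} [MeasurableSpace α] (μ : Measure α) [SigmaFinite μ] :
    ∃ ν : Measure α, IsFiniteMeasure ν ∧ ν ≤ μ ∧ μ ≪ ν := by
  obtain ⟨g, hg0, hgm, hgi⟩ := exists_pos_lintegral_lt_of_sigmaFinite μ one_ne_zero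
  have hm : Measurable fun x => min (g x : ℝ≥0∞) 1 := by fun_prop
  refine ⟨μ.withDensity fun x => min (g x : ℝ≥0∞) 1, ⟨?_⟩, ?_, ?_⟩
  · rw [withDensity_apply _ .univ, Measure.restrict_univ]
    exact (lintegral_mono fun x => min_le_left _ _).trans_lt (hgi.trans ENNReal.one_lt_top)
  · conv_rhs => rw [← withDensity_one (μ := μ)]
    exact withDensity_mono (.of_forall fun x => min_le_right _ _)
  · refine withDensity_absolutelyContinuous' hm.aemeasurable (.of_forall fun x => ?_)
    simp [(hg0 x).ne']

lemma MemDs.eGagliardo_lt_top (hs0 : 0 < s) (hs1 : s < 1) (hsN : 2 * s < N)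
    {u : EuclideanSpace ℝ (Fin N) → ℝ} (hu : MemDs s u) : eGagliardo s u < ⊤ := by
  rw [eGagliardo_eq_eLpNorm]
  exact (hu.memLp_diffQuot hs0 hs1 hsN).2

lemma eGagliardo_sub_le {u v : EuclideanSpace ℝ (Fin N) → ℝ}
    (hu : AEStronglyMeasurable u volume) (hv : AEStronglyMeasurable v volume) :
    eGagliardo s (fun x => u x - v x) ≤ eGagliardo s u + eGagliardo s v := by
  simp only [eGagliardo_eq_eLpNorm, diffQuot_sub]
  exact eLpNorm_sub_le (aestronglyMeasurable_diffQuot hu) (aestronglyMeasurable_diffQuot hv)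
    (by norm_num)

/-- A sequence bounded in `D^s(ℝ^N)` whose averages over balls tend to zero tends to zero in
`L²(ν)` for each finite measure `ν` below Lebesgue measure. -/
lemma tendsto_eLpNorm_of_tendsto_average (hs0 : 0 < s) (hsN : 2 * s < N)
    {v : ℕ → EuclideanSpace ℝ (Fin N) → ℝ}
    (hv : ∀ n, MemLp (v n) (ENNReal.ofReal (critExp N s)) volume) {R : ℝ≥0∞} (hR : R ≠ ⊤)
    (hvR : ∀ n, eGagliardo s (v n) ≤ R)
    (hav : ∀ (x : EuclideanSpace ℝ (Fin N)) (r : ℝ), 0 < r →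
      Tendsto (fun n => ⨍ y in Metric.ball x r, v n y) atTop (𝓝 0))
    (ν : Measure (EuclideanSpace ℝ (Fin N))) [IsFiniteMeasure ν] (hν : ν ≤ volume) :
    Tendsto (fun n => eLpNorm (v n) 2 ν) atTop (𝓝 0) := by
  have hp := two_lt_critExp hs0 hsN
  have hac : ν ≪ volume := Measure.absolutelyContinuous_of_le hν
  obtain ⟨C, hC⟩ := exists_eLpNorm_le_eGagliardo hs0 hsN
  -- At fixed radius the averages are bounded uniformly in x and n, so dominated convergence
  -- applies.
  have hmain : ∀ r : ℝ, 0 < r →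
      Tendsto (fun n => eLpNorm (fun x => ⨍ y in Metric.ball x r, v n y) 2 ν) atTop (𝓝 0) := by
    intro r hr
    set c := ENNReal.ofReal (unitVol N ^ (-(1 / critExp N s)) * r ^ (-(((N : ℝ) - 2 * s) / 2)))
    have hlim : Tendsto (fun n => ∫⁻ x, ‖⨍ y in Metric.ball x r, v n y‖ₑ ^ (2 : ℝ) ∂ν) atTop
        (𝓝 (∫⁻ _, 0 ∂ν)) := by
      refine tendsto_lintegral_of_dominated_convergence' (fun _ => (c * (C * R)) ^ (2 : ℝ))
        (fun n => ?_) (fun n => ?_) ?_ ?_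
      · exact (((aestronglyMeasurable_average (hv n).1 r).mono_ac hac).enorm).pow_const _
      · refine .of_forall fun x => ENNReal.rpow_le_rpow ?_ (by norm_num)
        refine (enorm_average_le_critExp hs0 hsN (hv n).1 x hr).trans ?_
        gcongr
        exact (hC _ (hv n)).trans (by gcongr; exact hvR n)
      · rw [lintegral_const]
        refine ENNReal.mul_ne_top (ENNReal.rpow_ne_top_of_nonneg (by norm_num) ?_)
          (measure_ne_top _ _)
        exact ENNReal.mul_ne_top ENNReal.ofReal_ne_top (ENNReal.mul_ne_top ENNReal.coe_ne_top hR)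
      · refine .of_forall fun x => ?_
        have h1 := ((hav x r hr).enorm).ennrpow_const 2
        simpa using h1
    have h2 := hlim.ennrpow_const (1 / 2)
    simp only [lintegral_zero] at h2
    rw [ENNReal.zero_rpow_of_pos (by norm_num)] at h2
    refine h2.congr fun n => ?_
    rw [eLpNorm_eq_lintegral_rpow_enorm_toReal (by norm_num) (by norm_num), ENNReal.toReal_ofNat]
  -- The radius is chosen before n: the error of averaging is small uniformly in n.
  have hsmall : Tendsto (fun r : ℝ => ENNReal.ofReal (unitVol N ^ (-(1 / 2) : ℝ) * r ^ s) * R)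
      (𝓝[>] 0) (𝓝 0) := by
    have h1 : Tendsto (fun r : ℝ => unitVol N ^ (-(1 / 2) : ℝ) * r ^ s) (𝓝[>] 0) (𝓝 0) := by
      have h0 : Tendsto (fun r : ℝ => r ^ s) (𝓝[>] 0) (𝓝 0) := by
        have := (Real.continuousAt_rpow_const 0 s (Or.inr hs0.le)).tendsto
        rw [Real.zero_rpow hs0.ne'] at this
        exact this.mono_left nhdsWithin_le_nhds
      simpa using h0.const_mul (unitVol N ^ (-(1 / 2) : ℝ))
    have h2 := ENNReal.Tendsto.mul_const (ENNReal.tendsto_ofReal h1) (Or.inr hR)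
    simpa using h2
  rw [ENNReal.tendsto_nhds_zero]
  intro ε hε
  have hε2 : 0 < ε / 2 := ENNReal.half_pos hε.ne'
  obtain ⟨r, hr1, hr⟩ := ((hsmall.eventually (gt_mem_nhds hε2)).and self_mem_nhdsWithin).exists
  have hr : 0 < r := hr
  filter_upwards [(hmain r hr).eventually (gt_mem_nhds hε2)] with n hn
  have hm := aestronglyMeasurable_average (hv n).1 r
  calc eLpNorm (v n) 2 ν
      = eLpNorm ((fun x => v n x - ⨍ y in Metric.ball x r, v n y) +
          fun x => ⨍ y in Metric.ball x r, v n y) 2 ν := by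
        congr 1; ext x; simp
    _ ≤ _ := eLpNorm_add_le (((hv n).1.sub hm).mono_ac hac) (hm.mono_ac hac) (by norm_num)
    _ ≤ ε / 2 + ε / 2 := by
        gcongr
        refine (eLpNorm_mono_measure _ hν).trans
          ((eLpNorm_sub_average_le hs0 (by simp; linarith) (hv n) hr).trans (le_trans ?_ hr1.le))
        gcongr
        exact hvR n
    _ = ε := ENNReal.add_halves ε

/-- Bounded sequences in `D^s(ℝ^N)` have subsequences converging almost everywhere to an element
of `D^s(ℝ^N)`. -/
theorem exists_subseq_tendsto_ae (hs0 : 0 < s) (hs1 : s < 1) (hsN : 2 * s < N)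
    {u : ℕ → EuclideanSpace ℝ (Fin N) → ℝ} (hu : ∀ n, MemDs s (u n)) {R : ℝ}
    (hR : ∀ n, eGagliardo s (u n) ≤ ENNReal.ofReal R) :
    ∃ (v : EuclideanSpace ℝ (Fin N) → ℝ) (σ : ℕ → ℕ), MemDs s v ∧ StrictMono σ ∧
      ∀ᵐ x, Tendsto (fun n => u (σ n) x) atTop (𝓝 (v x)) := by
  have hp := two_lt_critExp hs0 hsN
  obtain ⟨v, σ, hv, hσ, hav⟩ := exists_subseq_tendsto_average hs0 hs1 hsN hu hR
  obtain ⟨ν, hνf, hν, hac⟩ :=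
    exists_finite_measure_le (volume : Measure (EuclideanSpace ℝ (Fin N)))
  have hac' : ν ≪ volume := Measure.absolutelyContinuous_of_le hν
  have hL : Tendsto (fun n => eLpNorm (fun x => u (σ n) x - v x) 2 ν) atTop (𝓝 0) := by
    refine tendsto_eLpNorm_of_tendsto_average hs0 hsN (fun n => (hu (σ n)).1.sub hv.1)
      (R := ENNReal.ofReal R + eGagliardo s v)
      (ENNReal.add_ne_top.2 ⟨ENNReal.ofReal_ne_top, (hv.eGagliardo_lt_top hs0 hs1 hsN).ne⟩)
      (fun n => (eGagliardo_sub_le (hu _).1.1 hv.1.1).trans (by gcongr; exact hR _)) ?_ ν hν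
    intro x r hr
    have h1 := (hav x r hr).sub_const (⨍ y in Metric.ball x r, v y)
    rw [sub_self] at h1
    refine h1.congr fun n => ?_
    simp only [setAverage_eq, smul_eq_mul, Pi.sub_apply]
    rw [integral_sub (integrableOn_ball_of_memLp (by simp; linarith) (hu (σ n)).1 x r)
      (integrableOn_ball_of_memLp (by simp; linarith) hv.1 x r), mul_sub]
  obtain ⟨ρ, hρ, hρv⟩ := (tendstoInMeasure_of_tendsto_eLpNorm (by norm_num)
    (fun n => (hu (σ n)).1.1.mono_ac hac') (hv.1.1.mono_ac hac') hL).exists_seq_tendsto_ae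
  exact ⟨v, σ ∘ ρ, hv, hσ.comp hρ, hac.ae_le hρv⟩

/-- Lower semicontinuity of the Gagliardo norm under almost everywhere convergence. -/
lemma eGagliardo_le_of_tendsto_ae {u : ℕ → EuclideanSpace ℝ (Fin N) → ℝ}
    {v : EuclideanSpace ℝ (Fin N) → ℝ} (hu : ∀ n, AEStronglyMeasurable (u n) volume)
    (h : ∀ᵐ x, Tendsto (fun n => u n x) atTop (𝓝 (v x))) {a : ℝ≥0∞}
    (ha : Tendsto (fun n => eGagliardo s (u n)) atTop (𝓝 a)) : eGagliardo s v ≤ a := by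
  have h1 : ∀ᵐ p : EuclideanSpace ℝ (Fin N) × EuclideanSpace ℝ (Fin N),
      Tendsto (fun n => u n p.1) atTop (𝓝 (v p.1)) := Measure.quasiMeasurePreserving_fst.ae h
  have h2 : ∀ᵐ p : EuclideanSpace ℝ (Fin N) × EuclideanSpace ℝ (Fin N),
      Tendsto (fun n => u n p.2) atTop (𝓝 (v p.2)) := Measure.quasiMeasurePreserving_snd.ae h
  rw [← ha.liminf_eq]
  simp only [eGagliardo_eq_eLpNorm]
  refine Lp.eLpNorm_lim_le_liminf_eLpNorm (fun n => aestronglyMeasurable_diffQuot (hu n)) _ ?_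
  filter_upwards [h1, h2] with p h1 h2
  exact (h1.sub h2).div_const _

/-! ### The weighted integral: continuity and derivative -/

section Weight

variable {α : Type*} [MeasurableSpace α] {μ : Measure α} {p q : ℝ}

lemma aestronglyMeasurable_mul_abs_rpow {w u : α → ℝ} (hw : AEStronglyMeasurable w μ)
    (hu : AEStronglyMeasurable u μ) (q : ℝ) :
    AEStronglyMeasurable (fun x => w x * |u x| ^ q) μ :=
  hw.mul (hu.aemeasurable.abs.pow_const q).aestronglyMeasurable

/-- The Hölder inequality for the weighted `L^q` integral. -/
lemma eLpNorm_mul_abs_rpow_le (hq : 0 < q) (hqp : q < p) {w u : α → ℝ}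
    (hw : AEStronglyMeasurable w μ) (hu : AEStronglyMeasurable u μ) :
    eLpNorm (fun x => w x * |u x| ^ q) 1 μ ≤
      eLpNorm w (ENNReal.ofReal (p / (p - q))) μ * eLpNorm u (ENNReal.ofReal p) μ ^ q := by
  have hp : 0 < p := hq.trans hqp
  have hpq : 0 < p - q := by linarith
  have hτ : 0 < p / (p - q) := by positivity
  have hconj : (p / (p - q)).HolderConjugate (p / q) := by
    rw [Real.holderConjugate_iff]
    refine ⟨by rw [lt_div_iff₀ hpq]; linarith, ?_⟩
    field_simp
    ring
  have h := ENNReal.lintegral_mul_le_Lp_mul_Lq μ hconj (f := fun x => ‖w x‖ₑ)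
    (g := fun x => ‖u x‖ₑ ^ q) hw.enorm (hu.enorm.pow_const q)
  rw [eLpNorm_one_eq_lintegral_enorm,
    eLpNorm_eq_lintegral_rpow_enorm_toReal (by simpa using hτ) (by simp),
    eLpNorm_eq_lintegral_rpow_enorm_toReal (by simpa using hp) (by simp),
    ENNReal.toReal_ofReal hτ.le, ENNReal.toReal_ofReal hp.le, ← ENNReal.rpow_mul]
  convert h using 3
  · rename_i x
    rw [Pi.mul_apply, enorm_mul, Real.enorm_rpow_of_nonneg (abs_nonneg _) hq.le,
      ← Real.norm_eq_abs, enorm_norm]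
  · simp only [← ENNReal.rpow_mul]
    congr 1 with x
    congr 1
    field_simp
  · field_simp

lemma integrable_mul_abs_rpow (hq : 0 < q) (hqp : q < p) {w u : α → ℝ}
    (hw : MemLp w (ENNReal.ofReal (p / (p - q))) μ) (hu : MemLp u (ENNReal.ofReal p) μ) :
    Integrable (fun x => w x * |u x| ^ q) μ := by
  rw [← memLp_one_iff_integrable]
  refine ⟨aestronglyMeasurable_mul_abs_rpow hw.1 hu.1 q,
    (eLpNorm_mul_abs_rpow_le hq hqp hw.1 hu.1).trans_lt ?_⟩
  exact ENNReal.mul_lt_top hw.2 (ENNReal.rpow_lt_top_of_nonneg hq.le hu.2.ne)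

/-- The weighted `L^q` integral is continuous along sequences bounded in `L^p` that converge
almost everywhere. -/
theorem tendsto_integral_mul_abs_rpow (hq : 0 < q) (hqp : q < p) {w : α → ℝ}
    (hw : MemLp w (ENNReal.ofReal (p / (p - q))) μ) {u : ℕ → α → ℝ} {v : α → ℝ}
    (hu : ∀ n, MemLp (u n) (ENNReal.ofReal p) μ) (hv : MemLp v (ENNReal.ofReal p) μ)
    {M : ℝ≥0∞} (hM : M ≠ ⊤) (huM : ∀ n, eLpNorm (u n) (ENNReal.ofReal p) μ ≤ M)
    (h : ∀ᵐ x ∂μ, Tendsto (fun n => u n x) atTop (𝓝 (v x))) :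
    Tendsto (fun n => ∫ x, w x * |u n x| ^ q ∂μ) atTop (𝓝 (∫ x, w x * |v x| ^ q ∂μ)) := by
  have hpq : 0 < p - q := by linarith
  have hτ : 1 ≤ p / (p - q) := by rw [le_div_iff₀ hpq]; linarith
  have hτ' : 1 ≤ ENNReal.ofReal (p / (p - q)) := by simpa using hτ
  have hMq : M ^ q ≠ ⊤ := ENNReal.rpow_ne_top_of_nonneg hq.le hM
  -- Hölder on A puts all dependence on A into the fixed weight. Small sets then give uniform
  -- integrability, and complements of sets of finite measure give tightness.
  have hind : ∀ (A : Set α), MeasurableSet A → ∀ n,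
      eLpNorm (A.indicator fun x => w x * |u n x| ^ q) 1 μ ≤
        eLpNorm (A.indicator w) (ENNReal.ofReal (p / (p - q))) μ * M ^ q := by
    intro A hA n
    have heq : (A.indicator fun x => w x * |u n x| ^ q) =
        fun x => A.indicator w x * |u n x| ^ q := by
      ext x
      by_cases hx : x ∈ A <;> simp [hx]
    rw [heq]
    refine (eLpNorm_mul_abs_rpow_le hq hqp (hw.1.indicator hA) (hu n).1).trans ?_
    gcongr
    exact huM n
  have hδ : ∀ ε : ℝ, 0 < ε → ∃ δ : ℝ, 0 < δ ∧ ENNReal.ofReal δ * M ^ q ≤ ENNReal.ofReal ε := by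
    intro ε hε
    refine ⟨ε / ((M ^ q).toReal + 1), by positivity, ?_⟩
    rw [← ENNReal.ofReal_toReal hMq, ← ENNReal.ofReal_mul (by positivity)]
    refine ENNReal.ofReal_le_ofReal ?_
    rw [ENNReal.toReal_ofReal ENNReal.toReal_nonneg, div_mul_eq_mul_div,
      div_le_iff₀ (by positivity)]
    nlinarith [ENNReal.toReal_nonneg (a := M ^ q)]
  have hL : Tendsto (fun n => eLpNorm ((fun x => w x * |u n x| ^ q) - fun x => w x * |v x| ^ q)
      1 μ) atTop (𝓝 0) := by
    refine tendsto_Lp_of_tendsto_ae le_rfl ENNReal.one_ne_top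
      (fun n => aestronglyMeasurable_mul_abs_rpow hw.1 (hu n).1 q)
      (memLp_one_iff_integrable.2 (integrable_mul_abs_rpow hq hqp hw hv)) ?_ ?_ ?_
    · intro ε hε
      obtain ⟨δ, hδ0, hδ⟩ := hδ ε hε
      obtain ⟨η, hη, hwη⟩ := hw.eLpNorm_indicator_le hτ' ENNReal.ofReal_ne_top hδ0
      refine ⟨η, hη, fun n A hA hμA => (hind A hA n).trans (le_trans ?_ hδ)⟩
      gcongr
      exact hwη A hA hμA
    · rw [unifTight_iff_real]
      intro ε hε
      obtain ⟨δ, hδ0, hδ⟩ := hδ ε hε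
      obtain ⟨A, hA, hμA, hwA⟩ := hw.exists_eLpNorm_indicator_compl_lt ENNReal.ofReal_ne_top
        (ε := ENNReal.ofReal δ) (by simpa using hδ0)
      refine ⟨A, hμA.ne, fun n => (hind _ hA.compl n).trans (le_trans ?_ hδ)⟩
      gcongr
    · filter_upwards [h] with x hx
      exact ((hx.abs).rpow_const (Or.inr hq.le)).const_mul _
  refine tendsto_integral_of_L1' _ (integrable_mul_abs_rpow hq hqp hw hv).1
    (.of_forall fun n => integrable_mul_abs_rpow hq hqp hw (hu n)) hL

/-- Used with a = |u| + |φ|, so that |w|(|u| + |φ|)^q dominates both the weak integrand and, up to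
the factor q, the t-derivatives. -/
lemma abs_abs_rpow_mul_mul_le (hq : 2 < q) {y z a : ℝ} (hy : |y| ≤ a) (hz : |z| ≤ a) :
    |(|y| ^ (q - 2) * y * z)| ≤ a ^ q := by
  have ha : 0 ≤ a := (abs_nonneg y).trans hy
  rw [abs_mul, abs_mul, abs_of_nonneg (Real.rpow_nonneg (abs_nonneg y) _)]
  calc |y| ^ (q - 2) * |y| * |z| ≤ a ^ (q - 2) * a * a := by
        gcongr
    _ = a ^ (q - 2) * a ^ (2 : ℝ) := by rw [Real.rpow_two]; ring
    _ = a ^ q := by rw [← Real.rpow_add' ha (by linarith)]; congr 1; ring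

lemma integrable_mul_abs_rpow_mul_mul (hq : 2 < q) (hqp : q < p) {w u φ : α → ℝ}
    (hw : MemLp w (ENNReal.ofReal (p / (p - q))) μ) (hu : MemLp u (ENNReal.ofReal p) μ)
    (hφ : MemLp φ (ENNReal.ofReal p) μ) :
    Integrable (fun x => w x * |u x| ^ (q - 2) * u x * φ x) μ := by
  have hb := integrable_mul_abs_rpow (by linarith) hqp hw (hu.norm.add hφ.norm)
  refine hb.mono (((aestronglyMeasurable_mul_abs_rpow hw.1 hu.1 (q - 2)).mul hu.1).mul hφ.1)
    (.of_forall fun x => ?_)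
  simp only [Pi.add_apply, Real.norm_eq_abs]
  rw [mul_assoc, mul_assoc, abs_mul, abs_mul (w x), ← mul_assoc (|u x| ^ (q - 2))]
  have hs : 0 ≤ |u x| + |φ x| := by positivity
  rw [abs_of_nonneg hs, abs_of_nonneg (Real.rpow_nonneg hs _)]
  gcongr
  exact abs_abs_rpow_mul_mul_le hq (by linarith [abs_nonneg (φ x)]) (by linarith [abs_nonneg (u x)])

/-- Differentiation under the integral; |·|^q is differentiable even at 0 since q > 1, and |t| ≤ 1
gives a bound free of t. -/
lemma hasDerivAt_integral_mul_abs_rpow (hq : 2 < q) (hqp : q < p) {w u φ : α → ℝ}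
    (hw : MemLp w (ENNReal.ofReal (p / (p - q))) μ) (hu : MemLp u (ENNReal.ofReal p) μ)
    (hφ : MemLp φ (ENNReal.ofReal p) μ) :
    HasDerivAt (fun t : ℝ => ∫ x, w x * |u x + t * φ x| ^ q ∂μ)
      (q * ∫ x, w x * |u x| ^ (q - 2) * u x * φ x ∂μ) 0 := by
  have hut : ∀ t : ℝ, MemLp (fun x => u x + t * φ x) (ENNReal.ofReal p) μ := fun t =>
    hu.add (hφ.const_mul t)
  have hb := (integrable_mul_abs_rpow (by linarith) hqp hw (hu.norm.add hφ.norm)).norm.const_mul q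
  have h := hasDerivAt_integral_of_dominated_loc_of_deriv_le (μ := μ) (x₀ := (0 : ℝ))
    (F := fun t x => w x * |u x + t * φ x| ^ q)
    (F' := fun t x => q * (w x * |u x + t * φ x| ^ (q - 2) * (u x + t * φ x) * φ x))
    (Metric.ball_mem_nhds 0 one_pos)
    (.of_forall fun t => aestronglyMeasurable_mul_abs_rpow hw.1 (hut t).1 q)
    (integrable_mul_abs_rpow (by linarith) hqp hw (hut 0))
    ((integrable_mul_abs_rpow_mul_mul hq hqp hw (hut 0) hφ).1.const_mul q)
    (.of_forall fun x t ht => ?_) hb (.of_forall fun x t ht => ?_)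
  · have h2 := h.2
    rw [integral_const_mul] at h2
    simpa using h2
  · have ht1 : |t| ≤ 1 := by
      rw [mem_ball_zero_iff, Real.norm_eq_abs] at ht
      exact ht.le
    simp only [Pi.add_apply, Real.norm_eq_abs]
    rw [abs_mul, abs_of_pos (show 0 < q by linarith), mul_assoc (w x), mul_assoc (w x), abs_mul,
      abs_mul (w x)]
    have hs : 0 ≤ |u x| + |φ x| := by positivity
    rw [abs_of_nonneg hs, abs_of_nonneg (Real.rpow_nonneg hs _)]
    gcongr
    refine abs_abs_rpow_mul_mul_le hq ?_ (by linarith [abs_nonneg (u x)])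
    refine (abs_add_le _ _).trans ?_
    rw [abs_mul]
    nlinarith [abs_nonneg (φ x)]
  · have h1 : HasDerivAt (fun t : ℝ => u x + t * φ x) (φ x) t := by
      simpa using ((hasDerivAt_id t).mul_const (φ x)).const_add (u x)
    have h2 := ((hasDerivAt_abs_rpow (u x + t * φ x) (show 1 < q by linarith)).comp t h1).const_mul
      (w x)
    refine h2.congr_deriv ?_
    ring

end Weight

/-! ### The quadratic form and bounds for the numerator -/

lemma MemDs.integrable_formIntegrand (hs0 : 0 < s) (hs1 : s < 1) (hsN : 2 * s < N)
    {u v : EuclideanSpace ℝ (Fin N) → ℝ} (hu : MemDs s u) (hv : MemDs s v) :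
    Integrable (formIntegrand s u v) volume := by
  have h := (hu.memLp_diffQuot hs0 hs1 hsN).integrable_mul (hv.memLp_diffQuot hs0 hs1 hsN)
  exact h.congr (.of_forall fun p => diffQuot_mul u v p)

lemma MemDs.gagliardo_sq (hs0 : 0 < s) (hs1 : s < 1) (hsN : 2 * s < N)
    {u : EuclideanSpace ℝ (Fin N) → ℝ} (hu : MemDs s u) :
    gagliardo s u ^ 2 = ∫ p, formIntegrand s u u p := by
  have hf : ∀ p, formIntegrand s u u p =
      |u p.1 - u p.2| ^ 2 / ‖p.1 - p.2‖ ^ ((N : ℝ) + 2 * s) := fun p => by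
    rw [← diffQuot_mul, ← pow_two, diffQuot_sq]
  rw [integral_eq_lintegral_of_nonneg_ae (.of_forall fun p => by
      rw [hf]; simp only [Pi.zero_apply]; positivity)
    (hu.integrable_formIntegrand hs0 hs1 hsN hu).1, gagliardo, ← ENNReal.toReal_pow]
  congr 1
  simp only [hf, eGagliardo]
  rw [← ENNReal.rpow_two, ← ENNReal.rpow_mul]
  norm_num

/-- The squared seminorm is an explicit polynomial in t, so its derivative needs no limit under the
double integral. -/
lemma MemDs.gagliardo_add_mul_sq (hs0 : 0 < s) (hs1 : s < 1) (hsN : 2 * s < N)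
    {u v : EuclideanSpace ℝ (Fin N) → ℝ} (hu : MemDs s u) (hv : MemDs s v) (t : ℝ) :
    gagliardo s (fun x => u x + t * v x) ^ 2 =
      gagliardo s u ^ 2 + 2 * t * (∫ p, formIntegrand s u v p) + t ^ 2 * gagliardo s v ^ 2 := by
  have huu := hu.integrable_formIntegrand hs0 hs1 hsN hu
  have huv := hu.integrable_formIntegrand hs0 hs1 hsN hv
  have hvv := hv.integrable_formIntegrand hs0 hs1 hsN hv
  have huuv : Integrable (fun p => formIntegrand s u u p + 2 * t * formIntegrand s u v p) volume :=
    huu.add (huv.const_mul _)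
  rw [(hu.add_const_mul hs0 hsN hv t).gagliardo_sq hs0 hs1 hsN, hu.gagliardo_sq hs0 hs1 hsN,
    hv.gagliardo_sq hs0 hs1 hsN, ← integral_const_mul, ← integral_const_mul,
    ← integral_add huu (huv.const_mul _), ← integral_add huuv (hvv.const_mul _)]
  refine integral_congr_ae (.of_forall fun p => ?_)
  simp only [formIntegrand]
  ring

lemma gagliardo_nonneg (s : ℝ) (u : EuclideanSpace ℝ (Fin N) → ℝ) : 0 ≤ gagliardo s u :=
  ENNReal.toReal_nonneg

lemma MemDs.gagliardo_pos (hs0 : 0 < s) (hs1 : s < 1) (hsN : 2 * s < N)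
    {u : EuclideanSpace ℝ (Fin N) → ℝ} (hu : MemDs s u) (h : ¬ u =ᵐ[volume] 0) :
    0 < gagliardo s u := by
  have hp := two_lt_critExp hs0 hsN
  refine ENNReal.toReal_pos (fun h0 => h ?_) (hu.eGagliardo_lt_top hs0 hs1 hsN).ne
  obtain ⟨C, hC⟩ := exists_eLpNorm_le_eGagliardo hs0 hsN
  have h1 := hC u hu.1
  rwa [h0, mul_zero, nonpos_iff_eq_zero, eLpNorm_eq_zero_iff hu.1.1 (by simp; linarith)] at h1

lemma gagliardo_eq_zero_of_ae_eq_zero {u : EuclideanSpace ℝ (Fin N) → ℝ} (h : u =ᵐ[volume] 0) :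
    gagliardo s u = 0 := by
  have h0 : diffQuot s (0 : EuclideanSpace ℝ (Fin N) → ℝ) = 0 := by
    ext p; simp [diffQuot]
  rw [gagliardo, eGagliardo_eq_eLpNorm, eLpNorm_congr_ae (diffQuot_congr_ae h), h0, eLpNorm_zero,
    ENNReal.toReal_zero]

/-- Hölder against w followed by the Sobolev inequality. -/
lemma exists_abs_integral_le_gagliardo (hs0 : 0 < s) (hs1 : s < 1) (hsN : 2 * s < N)
    (hq : 0 < q) (hqp : q < critExp N s) {w : EuclideanSpace ℝ (Fin N) → ℝ}
    (hw : MemLp w (ENNReal.ofReal (critExp N s / (critExp N s - q))) volume) :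
    ∃ C : ℝ, 0 < C ∧ ∀ u : EuclideanSpace ℝ (Fin N) → ℝ, MemDs s u →
      |∫ x, w x * |u x| ^ q| ≤ C * gagliardo s u ^ q := by
  obtain ⟨C, hC⟩ := exists_eLpNorm_le_eGagliardo hs0 hsN
  set W := eLpNorm w (ENNReal.ofReal (critExp N s / (critExp N s - q))) volume
  -- The added 1 keeps the constant positive even if w = 0; it is divided by later.
  refine ⟨W.toReal * (C : ℝ) ^ q + 1, by positivity, fun u hu => ?_⟩
  have hg := (hu.eGagliardo_lt_top hs0 hs1 hsN).ne
  have h1 : ‖∫ x, w x * |u x| ^ q‖ₑ ≤ W * (C * eGagliardo s u) ^ q := by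
    refine (enorm_integral_le_lintegral_enorm _).trans ?_
    rw [← eLpNorm_one_eq_lintegral_enorm]
    refine (eLpNorm_mul_abs_rpow_le hq hqp hw.1 hu.1.1).trans ?_
    gcongr
    exact hC u hu.1
  have h2 := ENNReal.toReal_mono (ENNReal.mul_ne_top hw.2.ne (ENNReal.rpow_ne_top_of_nonneg hq.le
    (ENNReal.mul_ne_top ENNReal.coe_ne_top hg))) h1
  rw [toReal_enorm, ENNReal.toReal_mul, ← ENNReal.toReal_rpow, ENNReal.toReal_mul,
    ENNReal.coe_toReal, Real.mul_rpow C.coe_nonneg ENNReal.toReal_nonneg, ← mul_assoc,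
    Real.norm_eq_abs] at h2
  refine h2.trans ?_
  change _ * gagliardo s u ^ q ≤ _
  have := Real.rpow_nonneg (gagliardo_nonneg s u) q
  gcongr
  linarith

lemma not_ae_eq_zero_of_integral_pos (hq : 0 < q) {w u : EuclideanSpace ℝ (Fin N) → ℝ}
    (hu : 0 < ∫ x, w x * |u x| ^ q) : ¬ (u =ᵐ[volume] 0) := by
  intro h0
  have h1 : (fun x => w x * |u x| ^ q) =ᵐ[volume] 0 := by
    filter_upwards [h0] with x hx
    simp [hx, Real.zero_rpow hq.ne']
  rw [integral_congr_ae h1] at hu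
  simp at hu

lemma exists_memDs_integral_pos (hq : 0 < q) (hqp : q < critExp N s)
    {w : EuclideanSpace ℝ (Fin N) → ℝ}
    (hw : MemLp w (ENNReal.ofReal (critExp N s / (critExp N s - q))) volume)
    {Ω : Set (EuclideanSpace ℝ (Fin N))} (hΩ : IsOpen Ω) (hne : Ω.Nonempty)
    (hpos : ∀ᵐ x ∂(volume.restrict Ω), 0 < w x) :
    ∃ u : EuclideanSpace ℝ (Fin N) → ℝ, MemDs s u ∧ 0 < ∫ x, w x * |u x| ^ q := by
  obtain ⟨x₀, hx₀⟩ := hne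
  obtain ⟨r, hr, hrΩ⟩ := Metric.isOpen_iff.1 hΩ x₀ hx₀
  -- The support of this bump is exactly the ball of radius r inside Ω, so negative values of w
  -- elsewhere do not contribute.
  let f : ContDiffBump x₀ := ⟨r / 2, r, by linarith, by linarith⟩
  have hf : MemDs s (f : EuclideanSpace ℝ (Fin N) → ℝ) :=
    MemDs.of_contDiff f.contDiff f.hasCompactSupport
  refine ⟨f, hf, ?_⟩
  rw [ae_restrict_iff' hΩ.measurableSet] at hpos
  have hsupp : ∀ x, x ∈ Metric.ball x₀ r ↔ f x ≠ 0 := fun x => by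
    rw [← Function.mem_support, f.support_eq]
  have hnn : 0 ≤ᵐ[volume] fun x => w x * |f x| ^ q := by
    filter_upwards [hpos] with x hx
    by_cases hxr : x ∈ Metric.ball x₀ r
    · have := hx (hrΩ hxr)
      simp only [Pi.zero_apply]
      positivity
    · rw [hsupp, not_not] at hxr
      simp [hxr, Real.zero_rpow hq.ne']
  rw [integral_pos_iff_support_of_nonneg_ae hnn (integrable_mul_abs_rpow hq hqp hw hf.1)]
  refine (Metric.measure_ball_pos volume x₀ hr).trans_le (measure_mono_ae ?_)
  filter_upwards [hpos] with x hx hxr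
  have h1 := hx (hrΩ hxr)
  have h2 := (hsupp x).1 hxr
  have h3 : 0 < w x * |f x| ^ q := by positivity
  exact ne_of_gt h3

/-! ### First variation and existence of a maximizer -/

/-- The first order condition at a maximum of `f / (g + g^(p/2))`. -/
lemma deriv_eq_of_isLocalMax {f g : ℝ → ℝ} {f' b G p : ℝ} (hG : 0 < G)
    (hf : HasDerivAt f f' 0) (hg : HasDerivAt g (2 * b) 0) (hg0 : g 0 = G ^ 2) (hf0 : 0 < f 0)
    (hp : 2 < p) (hmax : IsLocalMax (fun t => f t / (g t + g t ^ (p / 2))) 0) :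
    b = (G ^ 2 + G ^ p) / ((2 + p * G ^ (p - 2)) * f 0) * f' := by
  have hg0' : g 0 ≠ 0 := by rw [hg0]; positivity
  -- Since g(0) > 0, the real power is differentiable there.
  have hd : HasDerivAt (fun t => g t + g t ^ (p / 2))
      (2 * b + 2 * b * (p / 2) * g 0 ^ (p / 2 - 1)) 0 := hg.add (hg.rpow_const (Or.inl hg0'))
  have hGp : (G ^ 2) ^ (p / 2) = G ^ p := by
    rw [← Real.rpow_natCast_mul hG.le]; congr 1; push_cast; ring
  have hGp' : (G ^ 2) ^ (p / 2 - 1) = G ^ (p - 2) := by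
    rw [← Real.rpow_natCast_mul hG.le]; congr 1; push_cast; ring
  have hpos : 0 < G ^ 2 + G ^ p := by positivity
  have hne : g 0 + g 0 ^ (p / 2) ≠ 0 := by rw [hg0, hGp]; exact hpos.ne'
  have h0 := hmax.hasDerivAt_eq_zero (hf.div hd hne)
  rw [div_eq_zero_iff, or_iff_left (pow_ne_zero 2 hne), hg0, hGp, hGp'] at h0
  have hpos2 : 0 < 2 + p * G ^ (p - 2) := by positivity
  rw [div_mul_eq_mul_div, eq_div_iff (by positivity)]
  linarith

/-- A maximizer of the quotient with positive numerator is a weak solution. -/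
theorem IsWeakSolution.of_maximizer (hs0 : 0 < s) (hs1 : s < 1) (hsN : 2 * s < N)
    (hq2 : 2 < q) (hqp : q < critExp N s) {w u : EuclideanSpace ℝ (Fin N) → ℝ}
    (hw : MemLp w (ENNReal.ofReal (critExp N s / (critExp N s - q))) volume) (hu : MemDs s u)
    (hupos : 0 < ∫ x, w x * |u x| ^ q) (hG : 0 < gagliardo s u)
    (hmax : ∀ v : EuclideanSpace ℝ (Fin N) → ℝ, MemDs s v → ¬ (v =ᵐ[volume] 0) →
      quotientJ s q w v ≤ quotientJ s q w u) :
    IsWeakSolution s q w (q * (gagliardo s u ^ 2 + gagliardo s u ^ critExp N s) /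
        ((2 + critExp N s * gagliardo s u ^ (critExp N s - 2)) * ∫ x, w x * |u x| ^ q)) u := by
  have hp := two_lt_critExp hs0 hsN
  refine ⟨hu, by positivity, fun φ hφ => ⟨hu.integrable_formIntegrand hs0 hs1 hsN hφ,
    integrable_mul_abs_rpow_mul_mul hq2 hqp hw hu.1 hφ.1, ?_⟩⟩
  set b := ∫ p, formIntegrand s u φ p
  set g : ℝ → ℝ := fun t => gagliardo s u ^ 2 + 2 * t * b + t ^ 2 * gagliardo s φ ^ 2 with hgdef
  have hgt : ∀ t, gagliardo s (fun x => u x + t * φ x) ^ 2 = g t :=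
    hu.gagliardo_add_mul_sq hs0 hs1 hsN hφ
  have hgJ : ∀ t, quotientJ s q w (fun x => u x + t * φ x) =
      (∫ x, w x * |u x + t * φ x| ^ q) / (g t + g t ^ (critExp N s / 2)) := by
    intro t
    rw [quotientJ, ← hgt, ← Real.rpow_natCast_mul (gagliardo_nonneg _ _)]
    congr 3
    push_cast
    ring
  have hgd : HasDerivAt g (2 * b) 0 := by
    have h1 : HasDerivAt (fun t : ℝ => 2 * t * b) (2 * b) 0 := by
      simpa using ((hasDerivAt_id (0 : ℝ)).const_mul 2).mul_const b
    have h2 : HasDerivAt (fun t : ℝ => t ^ 2 * gagliardo s φ ^ 2) 0 0 := by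
      simpa using (hasDerivAt_pow 2 (0 : ℝ)).mul_const (gagliardo s φ ^ 2)
    exact ((h1.const_add (gagliardo s u ^ 2)).add h2).congr_deriv (add_zero _)
  have hg0 : g 0 = gagliardo s u ^ 2 := by simp [hgdef]
  have hlm : IsLocalMax (fun t => (∫ x, w x * |u x + t * φ x| ^ q) /
      (g t + g t ^ (critExp N s / 2))) 0 := by
    -- For small t the perturbed function has positive seminorm, hence is a nonzero competitor.
    have hev : ∀ᶠ t in 𝓝 (0 : ℝ), 0 < g t :=
      hgd.continuousAt.eventually (lt_mem_nhds (by rw [hg0]; positivity))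
    filter_upwards [hev] with t ht
    rw [← hgJ, ← hgJ]
    simp only [zero_mul, add_zero]
    refine hmax _ (hu.add_const_mul hs0 hsN hφ t) fun h0 => ?_
    rw [← hgt, gagliardo_eq_zero_of_ae_eq_zero h0] at ht
    simp at ht
  have h := deriv_eq_of_isLocalMax hG (hasDerivAt_integral_mul_abs_rpow hq2 hqp hw hu.1 hφ.1) hgd
    hg0 (by simpa using hupos) hp hlm
  simp only [zero_mul, add_zero] at h
  rw [h]
  ring

/-- The quotient attains its supremum, and the supremum is positive. -/
theorem exists_maximizer (hs0 : 0 < s) (hs1 : s < 1) (hsN : 2 * s < N)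
    (hq2 : 2 < q) (hqp : q < critExp N s) {w : EuclideanSpace ℝ (Fin N) → ℝ}
    (hw : MemLp w (ENNReal.ofReal (critExp N s / (critExp N s - q))) volume)
    (hex : ∃ u : EuclideanSpace ℝ (Fin N) → ℝ, MemDs s u ∧ 0 < ∫ x, w x * |u x| ^ q) :
    ∃ u : EuclideanSpace ℝ (Fin N) → ℝ, MemDs s u ∧ 0 < ∫ x, w x * |u x| ^ q ∧
      ∀ v : EuclideanSpace ℝ (Fin N) → ℝ, MemDs s v → ¬ (v =ᵐ[volume] 0) →
        quotientJ s q w v ≤ quotientJ s q w u := by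
  have hp := two_lt_critExp hs0 hsN
  set p := critExp N s with hpdef
  have hq0 : 0 < q := by linarith
  have hnz : ∀ u : EuclideanSpace ℝ (Fin N) → ℝ, 0 < ∫ x, w x * |u x| ^ q →
      ¬ (u =ᵐ[volume] 0) := fun u hu => not_ae_eq_zero_of_integral_pos hq0 hu
  obtain ⟨C, hC0, hC⟩ := exists_abs_integral_le_gagliardo hs0 hs1 hsN hq0 hqp hw
  -- For a ≤ 1 the square dominates because q > 2, for a ≥ 1 the p-th power because q < p.
  have hden : ∀ a : ℝ, 0 < a → a ^ q ≤ a ^ 2 + a ^ p := by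
    intro a ha
    rcases le_total a 1 with h1 | h1
    · have : a ^ q ≤ a ^ (2 : ℝ) := Real.rpow_le_rpow_of_exponent_ge ha h1 hq2.le
      rw [Real.rpow_two] at this
      have : 0 ≤ a ^ p := by positivity
      linarith
    · have : a ^ q ≤ a ^ p := Real.rpow_le_rpow_of_exponent_le h1 hqp.le
      have : 0 ≤ a ^ 2 := by positivity
      linarith
  set A : Set ℝ := {j | ∃ v : EuclideanSpace ℝ (Fin N) → ℝ, MemDs s v ∧ ¬ (v =ᵐ[volume] 0) ∧
    quotientJ s q w v = j} with hA
  have hbdd : BddAbove A := by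
    refine ⟨C, ?_⟩
    rintro j ⟨v, hv, hv0, rfl⟩
    have ha := hv.gagliardo_pos hs0 hs1 hsN hv0
    rw [quotientJ, div_le_iff₀ (by positivity)]
    refine (le_abs_self _).trans ((hC v hv).trans ?_)
    gcongr
    exact hden _ ha
  obtain ⟨u₀, hu₀, hu₀pos⟩ := hex
  have hu₀A : quotientJ s q w u₀ ∈ A := ⟨u₀, hu₀, hnz u₀ hu₀pos, rfl⟩
  have hS : 0 < sSup A := by
    refine lt_of_lt_of_le ?_ (le_csSup hbdd hu₀A)
    have := hu₀.gagliardo_pos hs0 hs1 hsN (hnz u₀ hu₀pos)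
    rw [quotientJ]
    positivity
  set S := sSup A
  obtain ⟨j, -, hjS, hjA⟩ := exists_seq_tendsto_sSup ⟨_, hu₀A⟩ hbdd
  -- Dropping finitely many terms makes every quotient exceed S/2.
  obtain ⟨n₀, hn₀⟩ := (hjS.eventually (lt_mem_nhds (half_lt_self hS))).exists_forall_of_atTop
  choose v hv hv0 hvj using fun n => hjA (n + n₀)
  have hvS : Tendsto (fun n => quotientJ s q w (v n)) atTop (𝓝 S) := by
    simp only [hvj]
    exact (tendsto_add_atTop_iff_nat n₀).2 hjS
  have hvhalf : ∀ n, S / 2 < quotientJ s q w (v n) := fun n => by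
    rw [hvj]; exact hn₀ _ (by omega)
  have hapos : ∀ n, 0 < gagliardo s (v n) := fun n => (hv n).gagliardo_pos hs0 hs1 hsN (hv0 n)
  have hdpos : ∀ n, 0 < gagliardo s (v n) ^ 2 + gagliardo s (v n) ^ p := fun n => by
    have := hapos n
    positivity
  have hkey : ∀ n, S / 2 * (gagliardo s (v n) ^ 2 + gagliardo s (v n) ^ p) ≤
      C * gagliardo s (v n) ^ q := by
    intro n
    have h1 := hvhalf n
    rw [quotientJ, lt_div_iff₀ (hdpos n)] at h1
    exact h1.le.trans ((le_abs_self _).trans (hC _ (hv n)))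
  -- Discard the p-th power in `hkey` and divide by the square: the sequence cannot vanish since q >
  -- 2.
  have hlow : ∀ n, (S / (2 * C)) ^ (1 / (q - 2)) ≤ gagliardo s (v n) := by
    intro n
    have ha := hapos n
    rw [one_div, Real.rpow_inv_le_iff_of_pos (by positivity) ha.le (by linarith),
      div_le_iff₀ (by positivity)]
    have h1 := hkey n
    have h2 : gagliardo s (v n) ^ q = gagliardo s (v n) ^ (q - 2) * gagliardo s (v n) ^ 2 := by
      rw [← Real.rpow_two, ← Real.rpow_add ha]; congr 1; ring
    have h3 : 0 ≤ S / 2 * gagliardo s (v n) ^ p := by positivity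
    rw [h2] at h1
    have h4 : 0 < gagliardo s (v n) ^ 2 := by positivity
    refine le_of_mul_le_mul_right ?_ h4
    linarith
  -- Discard the square instead and divide by the q-th power: the sequence stays bounded since q <
  -- p.
  have hup : ∀ n, gagliardo s (v n) ≤ (2 * C / S) ^ (1 / (p - q)) := by
    intro n
    have ha := hapos n
    rw [one_div, Real.le_rpow_inv_iff_of_pos ha.le (by positivity) (by linarith),
      le_div_iff₀ hS]
    have h1 := hkey n
    have h2 : gagliardo s (v n) ^ p = gagliardo s (v n) ^ (p - q) * gagliardo s (v n) ^ q := by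
      rw [← Real.rpow_add ha]; congr 1; ring
    have h3 : 0 ≤ S / 2 * gagliardo s (v n) ^ 2 := by positivity
    rw [h2] at h1
    have h4 : 0 < gagliardo s (v n) ^ q := by positivity
    refine le_of_mul_le_mul_right ?_ h4
    linarith
  obtain ⟨a, haI, ρ, hρ, hρa⟩ := isCompact_Icc.tendsto_subseq
    (fun n => (⟨hlow n, hup n⟩ : gagliardo s (v n) ∈ Set.Icc _ _))
  have ha : 0 < a := lt_of_lt_of_le (by positivity) haI.1
  have hofReal : ∀ n, eGagliardo s (v n) = ENNReal.ofReal (gagliardo s (v n)) := fun n =>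
    (ENNReal.ofReal_toReal ((hv n).eGagliardo_lt_top hs0 hs1 hsN).ne).symm
  have hbound : ∀ n, eGagliardo s (v n) ≤ ENNReal.ofReal ((2 * C / S) ^ (1 / (p - q))) := fun n => by
    rw [hofReal]; exact ENNReal.ofReal_le_ofReal (hup n)
  obtain ⟨u, σ, hu, hσ, hae⟩ := exists_subseq_tendsto_ae hs0 hs1 hsN (fun n => hv (ρ n))
    (fun n => hbound (ρ n))
  obtain ⟨K, hK⟩ := exists_eLpNorm_le_eGagliardo hs0 hsN
  have hint : Tendsto (fun n => ∫ x, w x * |v (ρ (σ n)) x| ^ q) atTop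
      (𝓝 (∫ x, w x * |u x| ^ q)) := by
    refine tendsto_integral_mul_abs_rpow hq0 hqp hw (fun n => (hv _).1) hu.1
      (M := K * ENNReal.ofReal ((2 * C / S) ^ (1 / (p - q))))
      (ENNReal.mul_ne_top ENNReal.coe_ne_top ENNReal.ofReal_ne_top) (fun n => ?_) hae
    exact (hK _ (hv _).1).trans (by gcongr; exact hbound _)
  have haσ : Tendsto (fun n => gagliardo s (v (ρ (σ n)))) atTop (𝓝 a) :=
    hρa.comp hσ.tendsto_atTop
  have hlim : Tendsto (fun n => ∫ x, w x * |v (ρ (σ n)) x| ^ q) atTop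
      (𝓝 (S * (a ^ 2 + a ^ p))) := by
    have h1 := (hvS.comp (hρ.comp hσ).tendsto_atTop).mul
      ((haσ.pow 2).add (haσ.rpow_const (p := p) (Or.inl ha.ne')))
    refine h1.congr fun n => ?_
    simp only [Function.comp_apply, quotientJ]
    exact div_mul_cancel₀ _ (hdpos _).ne'
  -- The numerators have a second limit, as quotient times denominator; it is positive, so u is
  -- nonzero.
  have hI : ∫ x, w x * |u x| ^ q = S * (a ^ 2 + a ^ p) := tendsto_nhds_unique hint hlim
  have hIpos : 0 < ∫ x, w x * |u x| ^ q := by rw [hI]; positivity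
  have hua : gagliardo s u ≤ a := by
    refine ENNReal.toReal_le_of_le_ofReal ha.le
      (eGagliardo_le_of_tendsto_ae (fun n => (hv (ρ (σ n))).1.1) hae ?_)
    simp only [hofReal]
    exact ENNReal.tendsto_ofReal haσ
  have hupos := hu.gagliardo_pos hs0 hs1 hsN (hnz u hIpos)
  refine ⟨u, hu, hIpos, fun φ hφ hφ0 => (le_csSup hbdd ⟨φ, hφ, hφ0, rfl⟩).trans ?_⟩
  -- With the numerator fixed at S(a² + a^p), [u] ≤ a can only raise the quotient above S.
  rw [quotientJ, hI, le_div_iff₀ (by positivity)]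
  gcongr

end FracEigen

theorem theorem1 (N : ℕ) (s q : ℝ) (hs0 : 0 < s) (hs1 : s < 1) (hsN : 2 * s < N)
    (hq2 : 2 < q) (hq : q < FracEigen.critExp N s)
    (w : EuclideanSpace ℝ (Fin N) → ℝ)
    (hW1 : ∃ Ω : Set (EuclideanSpace ℝ (Fin N)), IsOpen Ω ∧ Ω.Nonempty ∧
      ∀ᵐ x ∂(volume.restrict Ω), 0 < w x)
    (hW2 : ∃ ν : ℝ, q < ν ∧ ν < FracEigen.critExp N s ∧
      ∀ τ ∈ Set.Icc (FracEigen.critExp N s / (FracEigen.critExp N s - q))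
          (ν / (ν - 1) * (FracEigen.critExp N s / (FracEigen.critExp N s - q))),
        MemLp w (ENNReal.ofReal τ) volume) :
    ∃ (u : EuclideanSpace ℝ (Fin N) → ℝ) (l : ℝ),
      FracEigen.IsWeakSolution s q w l u ∧
      ¬ (u =ᵐ[volume] 0) ∧
      l = q * (FracEigen.gagliardo s u ^ 2 + FracEigen.gagliardo s u ^ FracEigen.critExp N s) /
        ((2 + FracEigen.critExp N s * FracEigen.gagliardo s u ^ (FracEigen.critExp N s - 2)) *
          ∫ x, w x * |u x| ^ q) ∧
      ∀ v : EuclideanSpace ℝ (Fin N) → ℝ, FracEigen.MemDs s v → ¬ (v =ᵐ[volume] 0) →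
        FracEigen.quotientJ s q w v ≤ FracEigen.quotientJ s q w u := by
  obtain ⟨Ω, hΩ, hne, hpos⟩ := hW1
  obtain ⟨ν, hν, -, hτ⟩ := hW2
  have hp := FracEigen.two_lt_critExp hs0 hsN
  have hτ0 : 0 < FracEigen.critExp N s / (FracEigen.critExp N s - q) :=
    div_pos (by linarith) (by linarith)
  have hw : MemLp w
      (ENNReal.ofReal (FracEigen.critExp N s / (FracEigen.critExp N s - q))) volume := by
    -- The left endpoint is the Hölder dual exponent of p/q; it lies in the interval because ν/(ν -
    -- 1) ≥ 1.
    refine hτ _ ⟨le_rfl, le_mul_of_one_le_left hτ0.le ?_⟩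
    rw [one_le_div (by linarith)]
    linarith
  obtain ⟨u, hu, hupos, hmax⟩ := FracEigen.exists_maximizer hs0 hs1 hsN hq2 hq hw
    (FracEigen.exists_memDs_integral_pos (by linarith) hq hw hΩ hne hpos)
  have hu0 : ¬ (u =ᵐ[volume] 0) :=
    FracEigen.not_ae_eq_zero_of_integral_pos (by linarith) hupos
  exact ⟨u, _, FracEigen.IsWeakSolution.of_maximizer hs0 hs1 hsN hq2 hq hw hu hupos
    (hu.gagliardo_pos hs0 hs1 hsN hu0) hmax, hu0, rfl, hmax⟩
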